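/- Let $M\ge 2$ and consider $M$ bosonic modes with annihilation operators $a_1,\dots,a_M$ on $L^2(\mathbb R^M)$, $a_m=(x_m+\partial_{x_m})/\sqrt2$. For $\vec\alpha\in\mathbb C^M$ let $D(\vec\alpha)=\exp\big(\sum_m(\alpha_m a_m^\dagger-\alpha_m^* a_m)\big)$ be the displacement operator, write $\vec 1=(1,\dots,1)$, and let $\Pi_{-M}=\exp\big(i\pi(\sum_m a_m^\dagger a_m-a_+^\dagger a_+)\big)$ with $a_+=M^{-1/2}\sum_m a_m$ be the parity of the relative modes; equivalently, $\Pi_{-M}$ acts by $f\mapsto f\circ R$, where $R$ is the orthogonal reflection of $\mathbb R^M$ that fixes $\vec 1$ and is $-1$ on $\vec 1^\perp$. A state $\rho$ (a positive trace-class operator with trace one) is called genuinely multipartite entangled (GME) if it is not a finite or countable mixture $\sum_k p_k\,\rho_{\mathcal A_k}\otimes\rho_{\bar{\mathcal A}_k}$, with $p_k\ge0$, $\sum_k p_k=1$, where each $(\mathcal A_k\,|\,\bar{\mathcal A}_k)$ is a bipartition of the modes into two nonempty sets and $\rho_{\mathcal A_k}$, $\rho_{\bar{\mathcal A}_k}$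 are states of the modes in $\mathcal A_k$ and in $\bar{\mathcal A}_k$. Let $\rho$ be a state of the $M$ modes, let $\xi_1,\dots,\xi_N\in\mathbb C$, and let $\mathbf C\in\mathbb C^{N\times N}$ be the matrix $$[\mathbf C]_{n,n'}=\frac1N\operatorname{tr}\big[\rho\,\Pi_{-M}\,D\big((\xi_n-\xi_{n'})\vec 1\big)\big].$$ Then: 1. The entries of $\mathbf C$ are obtained with a controlled relative-mode parity followed by local displacements: with $c\Pi_{-M}=|{\uparrow}\rangle\langle{\uparrow}|\otimes\mathbb 1+|{\downarrow}\rangle\langle{\downarrow}|\otimes\Pi_{-M}$, $|+\rangle=(|{\uparrow}\rangle+|{\downarrow}\rangle)/\sqrt2$ and $\sigma_x=|{\uparrow}\rangle\langle{\downarrow}|+|{\downarrow}\rangle\langle{\uparrow}|$, for all $n,n'$, $$[\mathbf C]_{n,n'}=\frac1N\operatorname{tr}\Big[\big(\sigma_x\otimes D((\xi_n-\xi_{n'})\vec 1)\big)\;c\Pi_{-M}\,\big(|+\rangle\langle+|\otimes\rho\big)\,c\Pi_{-M}^\dagger\Big],$$ where all operators under the traces are trace class. 2. $\mathbf C=\mathbf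 C^\dagger$. 3. If the trace norm (the sum of the singular values) of $\mathbf C$ satisfies $\|\mathbf C\|_1>\dfrac{M}{2\sqrt{M-1}}$, then $\rho$ is GME. -/

import Mathlib

open MeasureTheory
open scoped InnerProductSpace ComplexConjugate

noncomputable section

namespace CVWitness

/-! ### Trace and density operators -/

/-- The operator `T` is trace class with trace `c`: in every orthonormal basis the sum of the
diagonal matrix elements converges unconditionally to `c`. -/
def HasTrace {H : Type} [NormedAddCommGroup H] [InnerProductSpace ℂ H]
    (T : H →L[ℂ] H) (c : ℂ) : Prop :=
  ∀ (ι : Type) (b : HilbertBasis ι ℂ H), HasSum (fun i => ⟪b i, T (b i)⟫_ℂ) c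

open Classical in
/-- The trace of an operator (the value `0` is used for operators that are not trace class). -/
def trace {H : Type} [NormedAddCommGroup H] [InnerProductSpace ℂ H] (T : H →L[ℂ] H) : ℂ :=
  if h : ∃ c, HasTrace T c then h.choose else 0

/-- Quantum states: positive trace-class operators of trace one. -/
def IsDensity {H : Type} [NormedAddCommGroup H] [InnerProductSpace ℂ H] [CompleteSpace H]
    (ρ : H →L[ℂ] H) : Prop :=
  ρ.IsPositive ∧ HasTrace ρ 1

/-! ### The Hilbert space of a finite family of modes -/

/-- The state space `L²(ℝ^ι)` of the modes labelled by `ι`, in the position (Schrödinger)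
representation, in which `a_m = (x_m + ∂/∂x_m)/√2`. -/
abbrev ModeSpace (ι : Type) [Fintype ι] : Type :=
  Lp ℂ 2 (volume : Measure (ι → ℝ))

theorem memLp_weightedComp {ι : Type} [Fintype ι] {S : (ι → ℝ) → (ι → ℝ)}
    (hS : MeasurePreserving S) {u : (ι → ℝ) → ℂ} (hu : Measurable u) (hu1 : ∀ x, ‖u x‖ = 1)
    (f : ModeSpace ι) : MemLp (fun x => u x * f (S x)) 2 volume :=
  ((Lp.memLp f).comp_measurePreserving hS).of_le_mul (c := 1)
    (hu.aestronglyMeasurable.mul ((Lp.memLp f).comp_measurePreserving hS).aestronglyMeasurable)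
    (.of_forall fun x => by simp [hu1])

/-- For a measure preserving map `S` and a measurable function `u` of modulus one,
the isometry `f ↦ u · (f ∘ S)`. -/
def weightedComp {ι : Type} [Fintype ι] (S : (ι → ℝ) → (ι → ℝ))
    (hS : MeasurePreserving S) (u : (ι → ℝ) → ℂ) (hu : Measurable u) (hu1 : ∀ x, ‖u x‖ = 1) :
    ModeSpace ι →L[ℂ] ModeSpace ι :=
  LinearMap.mkContinuous
    { toFun := fun f => (memLp_weightedComp hS hu hu1 f).toLp _
      map_add' := fun f g => by
        rw [← MemLp.toLp_add, MemLp.toLp_eq_toLp_iff]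
        filter_upwards [hS.quasiMeasurePreserving.ae (Lp.coeFn_add f g)] with x hx
        simp only [Pi.add_apply] at hx ⊢
        rw [hx, mul_add]
      map_smul' := fun c f => by
        rw [RingHom.id_apply, ← MemLp.toLp_const_smul, MemLp.toLp_eq_toLp_iff]
        filter_upwards [hS.quasiMeasurePreserving.ae (Lp.coeFn_smul c f)] with x hx
        simp only [Pi.smul_apply, smul_eq_mul] at hx ⊢
        rw [hx]; ring }
    1 (fun f => by
      rw [one_mul, LinearMap.coe_mk, AddHom.coe_mk, Lp.norm_toLp, Lp.norm_def]
      refine ENNReal.toReal_mono (Lp.eLpNorm_ne_top f) ?_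
      rw [← eLpNorm_comp_measurePreserving (Lp.aestronglyMeasurable f) hS]
      exact (eLpNorm_congr_norm_ae (.of_forall fun x => by simp [hu1])).le)

theorem coeFn_weightedComp {ι : Type} [Fintype ι] (S : (ι → ℝ) → (ι → ℝ))
    (hS : MeasurePreserving S) (u : (ι → ℝ) → ℂ) (hu : Measurable u) (hu1 : ∀ x, ‖u x‖ = 1)
    (f : ModeSpace ι) :
    weightedComp S hS u hu hu1 f =ᵐ[volume] fun x => u x * f (S x) :=
  (memLp_weightedComp hS hu hu1 f).coeFn_toLp

/-- The displacement operator `D(α) = exp(∑ₘ (αₘ aₘ† - αₘ* aₘ)) = ⨂ₘ Dₘ(αₘ)`. With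
`qₘ = √2 Re αₘ` and `pₘ = √2 Im αₘ` the exponent is `∑ₘ (i pₘ xₘ - qₘ ∂/∂xₘ)`, so that
`(D(α) f)(x) = ∏ₘ exp(i (pₘ xₘ - qₘ pₘ / 2)) · f(x - q)`. -/
def displacement {ι : Type} [Fintype ι] (α : ι → ℂ) : ModeSpace ι →L[ℂ] ModeSpace ι :=
  weightedComp (fun x => x - fun m => √2 * (α m).re) (measurePreserving_sub_right volume _)
    (fun x => ∏ m, Complex.exp
      (((√2 * (α m).im * x m - (√2 * (α m).re) * (√2 * (α m).im) / 2 : ℝ) : ℂ) * Complex.I))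
    (by fun_prop)
    (fun x => by
      rw [norm_prod]
      exact Finset.prod_eq_one fun m _ => Complex.norm_exp_ofReal_mul_I _)

/-- The reflection of `ℝ^M` that fixes the centre-of-mass direction `(1, …, 1)` and is `-1` on its
orthogonal complement: `x_m ↦ -x_m + (2/M) ∑_{m'} x_{m'}`. -/
def relReflection (M : ℕ) : (Fin M → ℝ) →ₗ[ℝ] (Fin M → ℝ) where
  toFun x := fun m => -x m + 2 / M * ∑ m', x m'
  map_add' x y := by
    ext m; simp only [Pi.add_apply, Finset.sum_add_distrib]; ring
  map_smul' c x := by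
    ext m
    simp only [Pi.smul_apply, smul_eq_mul, RingHom.id_apply, ← Finset.mul_sum]; ring

theorem relReflection_relReflection (M : ℕ) : relReflection M ∘ₗ relReflection M = LinearMap.id := by
  ext1 i
  ext m
  have hM : (M : ℝ) ≠ 0 := by
    have := m.pos
    positivity
  simp [relReflection, Finset.sum_add_distrib]
  field_simp
  ring

theorem measurePreserving_relReflection (M : ℕ) : MeasurePreserving (relReflection M) := by
  have h : LinearMap.det (relReflection M) * LinearMap.det (relReflection M) = 1 := by
    rw [← LinearMap.det_comp, relReflection_relReflection, LinearMap.det_id]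
  have h0 : LinearMap.det (relReflection M) ≠ 0 := fun h' => by simp [h'] at h
  refine ⟨(LinearMap.continuous_of_finiteDimensional _).measurable, ?_⟩
  rw [Real.map_linearMap_volume_pi_eq_smul_volume_pi h0]
  have h1 : |(LinearMap.det (relReflection M))⁻¹| = 1 := by
    rcases mul_self_eq_one_iff.mp h with h2 | h2 <;> simp [h2]
  rw [h1]; simp

/-- The relative-mode parity `Π_{-M} = exp(iπ (∑ₘ aₘ† aₘ - a₊† a₊))`, where
`a₊ = M^{-1/2} ∑ₘ aₘ`: the parity operator of the `M - 1` modes orthogonal to `a₊`. It is the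
multiport beamsplitter with `Π_{-M} aₘ Π_{-M} = -aₘ + (2/M) ∑_{m'} a_{m'}`, acting in the position
representation as `f ↦ f ∘ R`, with `R` the reflection `relReflection M`. -/
def relParity (M : ℕ) : ModeSpace (Fin M) →L[ℂ] ModeSpace (Fin M) :=
  weightedComp (relReflection M) (measurePreserving_relReflection M) (fun _ => 1)
    measurable_const (fun _ => norm_one)

/-! ### Genuine multipartite entanglement -/

theorem memLp_tensor {M : ℕ} (A : Finset (Fin M))
    (f : ModeSpace {m // m ∈ A}) (g : ModeSpace {m // m ∉ A}) :
    MemLp (fun x : Fin M → ℝ => f (fun m => x m) * g (fun m => x m)) 2 volume := by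
  have key : MemLp (fun z : ({m // m ∈ A} → ℝ) × ({m // m ∉ A} → ℝ) => f z.1 * g z.2) 2
      (volume.prod volume) := by
    rw [memLp_two_iff_integrable_sq_norm]
    · have hf := (memLp_two_iff_integrable_sq_norm (Lp.memLp f).1).1 (Lp.memLp f)
      have hg := (memLp_two_iff_integrable_sq_norm (Lp.memLp g).1).1 (Lp.memLp g)
      simpa only [norm_mul, mul_pow] using hf.mul_prod hg
    · exact ((Lp.memLp f).1.comp_fst).mul ((Lp.memLp g).1.comp_snd)
  have e := volume_preserving_piEquivPiSubtypeProd (fun _ : Fin M => ℝ) (fun m => m ∈ A)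
  have e' : MeasurePreserving
      (fun x : Fin M → ℝ => ((fun m => x m, fun m => x m) :
        ({m // m ∈ A} → ℝ) × ({m // m ∉ A} → ℝ))) volume (volume.prod volume) := by
    convert e
    any_goals rfl
    rw [Measure.volume_eq_prod]
    congr!
  exact key.comp_measurePreserving e'

/-- The product vector `f ⊗ g`, for `f` a vector of the modes in `A` and `g` a vector of the
remaining modes. -/
def tensor {M : ℕ} (A : Finset (Fin M))
    (f : ModeSpace {m // m ∈ A}) (g : ModeSpace {m // m ∉ A}) : ModeSpace (Fin M) :=
  (memLp_tensor A f g).toLp _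

/-- `T = ρ_A ⊗ ρ_Ā` for some states `ρ_A`, `ρ_Ā` of the modes in `A` and of the remaining modes
(an operator is determined by its values on product vectors, which are total). -/
def IsProductState {M : ℕ} (A : Finset (Fin M))
    (T : ModeSpace (Fin M) →L[ℂ] ModeSpace (Fin M)) : Prop :=
  ∃ (ρA : ModeSpace {m // m ∈ A} →L[ℂ] ModeSpace {m // m ∈ A})
    (ρB : ModeSpace {m // m ∉ A} →L[ℂ] ModeSpace {m // m ∉ A}),
    IsDensity ρA ∧ IsDensity ρB ∧ ∀ f g, T (tensor A f g) = tensor A (ρA f) (ρB g)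

/-- `ρ` is a (finite or countably infinite) statistical mixture of states, each of which is a
product with respect to some bipartition `(A | Ā)` of the modes into two nonempty parts. -/
def IsBiseparableMixture {M : ℕ} (ρ : ModeSpace (Fin M) →L[ℂ] ModeSpace (Fin M)) : Prop :=
  ∃ (p : ℕ → ℝ) (A : ℕ → Finset (Fin M))
    (T : ℕ → (ModeSpace (Fin M) →L[ℂ] ModeSpace (Fin M))),
    (∀ k, 0 ≤ p k) ∧ HasSum p 1 ∧
    (∀ k, (A k).Nonempty ∧ (A k)ᶜ.Nonempty ∧ IsProductState (A k) (T k)) ∧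
    HasSum (fun k => (p k : ℂ) • T k) ρ

/-- A state is genuinely multipartite entangled if it is not a mixture of biseparable states. -/
def IsGME {M : ℕ} (ρ : ModeSpace (Fin M) →L[ℂ] ModeSpace (Fin M)) : Prop :=
  ¬ IsBiseparableMixture ρ

/-! ### The measurement circuit -/

/-- The joint space `ℂ² ⊗ H` of a qubit and a system `H`; the components `0` and `1` belong to the
qubit states `|↑⟩` and `|↓⟩`. -/
abbrev WithQubit (H : Type) [NormedAddCommGroup H] : Type := PiLp 2 (fun _ : Fin 2 => H)

/-- The operator `A ⊗ T` on `ℂ² ⊗ H`. -/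
def qubitTensor {H : Type} [NormedAddCommGroup H] [InnerProductSpace ℂ H]
    (A : Matrix (Fin 2) (Fin 2) ℂ) (T : H →L[ℂ] H) : WithQubit H →L[ℂ] WithQubit H :=
  (PiLp.continuousLinearEquiv 2 ℂ (fun _ : Fin 2 => H)).symm.toContinuousLinearMap ∘L
    ContinuousLinearMap.pi fun i => ∑ j, A i j • (T ∘L PiLp.proj 2 (fun _ : Fin 2 => H) j)

/-- The controlled operation `cU = |↑⟩⟨↑| ⊗ 1 + |↓⟩⟨↓| ⊗ U`. -/
def controlled {H : Type} [NormedAddCommGroup H] [InnerProductSpace ℂ H]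
    (U : H →L[ℂ] H) : WithQubit H →L[ℂ] WithQubit H :=
  qubitTensor !![1, 0; 0, 0] (ContinuousLinearMap.id ℂ H) + qubitTensor !![0, 0; 0, 1] U

/-- The operator `(σₓ ⊗ D(ξ·1)) cΠ_{-M} (|+⟩⟨+| ⊗ ρ) cΠ_{-M}†`: the qubit is prepared in `|+⟩`,
the controlled relative-mode parity is applied, then `σₓ` is measured on the qubit together with the
local displacements `D(ξ)` on every mode. -/
def circuitOperator {M : ℕ} (ρ : ModeSpace (Fin M) →L[ℂ] ModeSpace (Fin M)) (ξ : ℂ) :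
    WithQubit (ModeSpace (Fin M)) →L[ℂ] WithQubit (ModeSpace (Fin M)) :=
  qubitTensor !![0, 1; 1, 0] (displacement fun _ : Fin M => ξ) ∘L controlled (relParity M) ∘L
    qubitTensor !![1/2, 1/2; 1/2, 1/2] ρ ∘L (controlled (relParity M)).adjoint

/-- The matrix `C` with entries `(1/N) tr[ρ Π_{-M} D((ξ_n - ξ_{n'})·1)]`. -/
def witnessMatrix {M N : ℕ} (ρ : ModeSpace (Fin M) →L[ℂ] ModeSpace (Fin M)) (ξ : Fin N → ℂ) :
    Matrix (Fin N) (Fin N) ℂ :=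
  Matrix.of fun n n' =>
    1 / (N : ℂ) * trace (ρ ∘L relParity M ∘L displacement fun _ : Fin M => ξ n - ξ n')

/-- The trace norm of a square matrix: the sum of its singular values. -/
def matrixTraceNorm {N : ℕ} (C : Matrix (Fin N) (Fin N) ℂ) : ℝ :=
  ∑ k : Fin N, (Matrix.toEuclideanLin C).singularValues k

end CVWitness

end

noncomputable section

namespace CVWitness

/-!
The matrix of a mixture is the mixture of the matrices of its pure components, so by convexity of
the trace norm it suffices to bound the matrix of a product vector `f ⊗ g` along a bipartition
`(A | Ā)` into `m` and `l` modes. In the position representation `Π_{-M} D(ξ·1)` relates a point `x`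
to its reflection `2y - x` in the diagonal point `(y, …, y)`, where `y` is the mean position up to a
shift. This reflection acts separately on the two blocks of coordinates. Integrating out the
relative positions inside each block turns the matrix elements into
`M ∫ e^{ipy} F(y, s) G(y, c - s) dy ds`, where `F` and `G` are partial Wigner correlations of `f`
and `g`, and `p` and `c` are linear in `ξ = ξₙ - ξₙ'`. Hence the contributions of `ξₙ` and `ξₙ'` can
be absorbed into phases and translations of `F` and `G`, and the matrix is `M` times a matrix of
inner products `⟨aₙ, bₙ'⟩` with `‖aₙ‖ = ‖F‖` and `‖bₙ'‖ = ‖G‖`, whose trace norm is at most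
`N ‖F‖ ‖G‖`.
The Cauchy-Schwarz inequality gives `‖F‖ ≤ ‖f‖² / √(2m)` and `‖G‖ ≤ ‖g‖² / √(2l)`, and the bound
`M / (2 √(ml))` is largest for `ml = M - 1`.
-/

/-! ### Traces of ensembles -/

section Ensemble

variable {H K : Type} [NormedAddCommGroup H] [InnerProductSpace ℂ H]
  [NormedAddCommGroup K] [InnerProductSpace ℂ K] {σ : Type*}

theorem HasTrace.trace_eq [CompleteSpace H] {T : H →L[ℂ] H} {c : ℂ} (h : HasTrace T c) :
    trace T = c := by
  obtain ⟨w, b, -⟩ := exists_hilbertBasis ℂ H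
  have h' : ∃ c, HasTrace T c := ⟨c, h⟩
  rw [trace, dif_pos h']
  exact (h'.choose_spec w b).unique (h w b)

theorem hasSum_sq_norm_inner {ι : Type} (b : HilbertBasis ι ℂ H) (x : H) :
    HasSum (fun i => ‖⟪b i, x⟫_ℂ‖ ^ 2) (‖x‖ ^ 2) := by
  have h := Complex.hasSum_re (b.hasSum_inner_mul_inner x x)
  rw [inner_self_eq_norm_sq_to_K] at h
  convert h using 1
  · ext i
    rw [← inner_conj_symm x (b i), Complex.conj_mul']
    norm_cast
  · norm_cast

theorem summable_sq_norm_inner {ι : Type} (b : HilbertBasis ι ℂ H) {v : σ → H}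
    (hv : Summable fun s => ‖v s‖ ^ 2) :
    Summable fun p : σ × ι => ‖⟪b p.2, v p.1⟫_ℂ‖ ^ 2 := by
  refine (summable_prod_of_nonneg fun p => by positivity).2
    ⟨fun s => (hasSum_sq_norm_inner b (v s)).summable, ?_⟩
  simpa only [(hasSum_sq_norm_inner b _).tsum_eq] using hv

theorem hasTrace_of_hasSum_inner {u v : σ → H} {T : H →L[ℂ] H}
    (hu : Summable fun s => ‖u s‖ ^ 2) (hv : Summable fun s => ‖v s‖ ^ 2)
    (hT : ∀ x y, HasSum (fun s => ⟪x, u s⟫_ℂ * ⟪v s, y⟫_ℂ) ⟪x, T y⟫_ℂ) :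
    HasTrace T (∑' s, ⟪v s, u s⟫_ℂ) := by
  intro ι b
  have hsum : Summable fun p : σ × ι => ⟪b p.2, u p.1⟫_ℂ * ⟪v p.1, b p.2⟫_ℂ := by
    refine .of_norm_bounded ((summable_sq_norm_inner b hu).add (summable_sq_norm_inner b hv))
      fun p => ?_
    rw [norm_mul, norm_inner_symm (v p.1)]
    nlinarith [two_mul_le_add_sq ‖⟪b p.2, u p.1⟫_ℂ‖ ‖⟪b p.2, v p.1⟫_ℂ‖,
      sq_nonneg ‖⟪b p.2, u p.1⟫_ℂ‖, sq_nonneg ‖⟪b p.2, v p.1⟫_ℂ‖]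
  have hrow : HasSum (fun s => ⟪v s, u s⟫_ℂ) _ := hsum.hasSum.prod_fiberwise fun s => by
    simpa only [mul_comm] using b.hasSum_inner_mul_inner (v s) (u s)
  rw [hrow.tsum_eq]
  exact ((Equiv.prodComm ι σ).hasSum_iff.2 hsum.hasSum).prod_fiberwise fun i => hT (b i) (b i)

/-- The operator `T` is the norm convergent sum `∑ₛ |vₛ⟩⟨vₛ|`, with `∑ₛ ‖vₛ‖² = w`: for `w = 1`,
the mixed state of an ensemble of (subnormalised) pure states. -/
structure IsEnsemble (v : σ → H) (w : ℝ) (T : H →L[ℂ] H) : Prop where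
  hasSum_weight : HasSum (fun s => ‖v s‖ ^ 2) w
  hasSum : HasSum (fun s => InnerProductSpace.rankOne ℂ (v s) (v s)) T

theorem summable_rankOne [CompleteSpace H] {v : σ → H} (hv : Summable fun s => ‖v s‖ ^ 2) :
    Summable fun s => InnerProductSpace.rankOne ℂ (v s) (v s) :=
  .of_norm <| by simpa [← pow_two] using hv

namespace IsEnsemble

variable {v : σ → H} {w : ℝ} {T : H →L[ℂ] H}

theorem hasSum_inner (h : IsEnsemble v w T) (x y : H) :
    HasSum (fun s => ⟪x, v s⟫_ℂ * ⟪v s, y⟫_ℂ) ⟪x, T y⟫_ℂ := by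
  have h1 := (innerSL ℂ x).hasSum ((ContinuousLinearMap.apply ℂ H y).hasSum h.hasSum)
  simpa [inner_smul_right, mul_comm] using h1

theorem summable_inner (h : IsEnsemble v w T) (B : H →L[ℂ] H) :
    Summable fun s => ⟪v s, B (v s)⟫_ℂ := by
  refine .of_norm_bounded (h.hasSum_weight.summable.mul_left ‖B‖) fun s => ?_
  calc ‖⟪v s, B (v s)⟫_ℂ‖ ≤ ‖v s‖ * (‖B‖ * ‖v s‖) :=
        (norm_inner_le_norm _ _).trans (by gcongr; exact B.le_opNorm _)
    _ = ‖B‖ * ‖v s‖ ^ 2 := by ring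

theorem smul (h : IsEnsemble v w T) {c : ℝ} (hc : 0 ≤ c) :
    IsEnsemble (fun s => (√c : ℂ) • v s) (c * w) ((c : ℂ) • T) where
  hasSum_weight := by
    simpa [norm_smul, mul_pow, Real.sq_sqrt hc] using h.hasSum_weight.mul_left c
  hasSum := by
    convert h.hasSum.const_smul (c : ℂ) using 2 with s
    rw [map_smulₛₗ, map_smulₛₗ, smul_apply, smul_smul, Complex.conj_ofReal, RingHom.id_apply,
      ← Complex.ofReal_mul, Real.mul_self_sqrt hc]

variable [CompleteSpace H]

theorem of_inner (hw : HasSum (fun s => ‖v s‖ ^ 2) w)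
    (h : ∀ x y, HasSum (fun s => ⟪x, v s⟫_ℂ * ⟪v s, y⟫_ℂ) ⟪x, T y⟫_ℂ) : IsEnsemble v w T := by
  obtain ⟨T', hT'⟩ := summable_rankOne hw.summable
  suffices T' = T from ⟨hw, this ▸ hT'⟩
  ext1 y
  exact ext_inner_left ℂ fun x => (hasSum_inner ⟨hw, hT'⟩ x y).unique (h x y)

theorem sigma {κ : Type*} {τ : κ → Type*} {v : ∀ k, τ k → H} {p : κ → ℝ} {T : κ → H →L[ℂ] H}
    {ρ : H →L[ℂ] H} (h : ∀ k, IsEnsemble (v k) (p k) (T k)) (hp : HasSum p w) (hT : HasSum T ρ) :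
    IsEnsemble (fun s : Σ k, τ k => v s.1 s.2) w ρ := by
  have hsum : Summable fun s : Σ k, τ k => ‖v s.1 s.2‖ ^ 2 := by
    refine (summable_sigma_of_nonneg fun s => by positivity).2
      ⟨fun k => (h k).hasSum_weight.summable, ?_⟩
    simpa only [(h _).hasSum_weight.tsum_eq] using hp.summable
  exact ⟨hp.sigma_of_hasSum (fun k => (h k).hasSum_weight) hsum,
    hT.sigma_of_hasSum (fun k => (h k).hasSum) (summable_rankOne hsum)⟩

theorem hasTrace_comp [CompleteSpace K] (h : IsEnsemble v w T) (A : H →L[ℂ] K) (B : K →L[ℂ] H) :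
    HasTrace (A ∘L T ∘L B) (∑' s, ⟪v s, B (A (v s))⟫_ℂ) := by
  have hsummable (C : H →L[ℂ] K) : Summable fun s => ‖C (v s)‖ ^ 2 := by
    refine (h.hasSum_weight.summable.mul_left (‖C‖ ^ 2)).of_nonneg_of_le
      (fun s => by positivity) fun s => ?_
    rw [← mul_pow]
    gcongr
    exact C.le_opNorm _
  simp_rw [← B.adjoint_inner_left]
  refine hasTrace_of_hasSum_inner (hsummable A) (hsummable B.adjoint) fun x y => ?_
  simpa only [A.adjoint_inner_left, B.adjoint_inner_left, ContinuousLinearMap.comp_apply] using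
    h.hasSum_inner (A.adjoint x) (B y)

end IsEnsemble

/-- The ensemble consists of the images of an orthonormal basis under the square root of `ρ`. -/
theorem IsDensity.exists_isEnsemble [CompleteSpace H] {ρ : H →L[ℂ] H} (hρ : IsDensity ρ) :
    ∃ (σ : Type) (v : σ → H), IsEnsemble v 1 ρ := by
  obtain ⟨σ, b, -⟩ := exists_hilbertBasis ℂ H
  have hρ_nonneg : 0 ≤ ρ := (ContinuousLinearMap.nonneg_iff_isPositive ρ).2 hρ.1
  have hsymm (x y : H) : ⟪CFC.sqrt ρ x, y⟫_ℂ = ⟪x, CFC.sqrt ρ y⟫_ℂ :=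
    ((ContinuousLinearMap.nonneg_iff_isPositive _).1 (CFC.sqrt_nonneg ρ)).isSymmetric x y
  have hsq (x : H) : CFC.sqrt ρ (CFC.sqrt ρ x) = ρ x := by
    rw [← mul_apply_eq_comp, CFC.sqrt_mul_sqrt_self ρ hρ_nonneg]
  refine ⟨σ, fun i => CFC.sqrt ρ (b i), .of_inner ?_ fun x y => ?_⟩
  · rw [← Complex.one_re]
    convert Complex.hasSum_re (hρ.2 σ b) using 2 with i
    rw [← hsq, ← hsymm, inner_self_eq_norm_sq_to_K]
    norm_cast
  · simpa only [hsymm, hsq] using b.hasSum_inner_mul_inner (CFC.sqrt ρ x) (CFC.sqrt ρ y)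

end Ensemble

/-! ### Duality for the trace norm of a matrix -/

section TraceNorm

theorem exists_orthonormalBasis_apply_eq_singularValues_smul {𝕜 E F : Type*} [RCLike 𝕜]
    [NormedAddCommGroup E] [InnerProductSpace 𝕜 E] [FiniteDimensional 𝕜 E]
    [NormedAddCommGroup F] [InnerProductSpace 𝕜 F] [FiniteDimensional 𝕜 F] {n : ℕ}
    (hE : Module.finrank 𝕜 E = n) (hF : Module.finrank 𝕜 F = n) (T : E →ₗ[𝕜] F) :
    ∃ (e : OrthonormalBasis (Fin n) 𝕜 E) (f : OrthonormalBasis (Fin n) 𝕜 F),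
      ∀ k, T (e k) = (T.singularValues k : 𝕜) • f k := by
  have hsym := T.isSymmetric_adjoint_comp_self
  set e := hsym.eigenvectorBasis hE
  set s : Fin n → ℝ := fun k => T.singularValues k
  have hinner (j k) : ⟪T (e j), T (e k)⟫_𝕜 = if j = k then (s k : 𝕜) ^ 2 else 0 := by
    rw [← LinearMap.adjoint_inner_right, ← LinearMap.comp_apply, hsym.apply_eigenvectorBasis,
      ← T.sq_singularValues_fin hE, inner_smul_right, orthonormal_iff_ite.1 e.orthonormal]
    split_ifs <;> simp [s]
  have horth : Orthonormal 𝕜 ({k | s k ≠ 0}.domRestrict fun k => (s k : 𝕜)⁻¹ • T (e k)) := by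
    rw [orthonormal_iff_ite]
    rintro ⟨j, hj⟩ ⟨k, hk⟩
    simp only [Set.domRestrict_apply, inner_smul_left, inner_smul_right, hinner, Subtype.mk.injEq]
    split_ifs with h
    · subst h
      have : (s j : 𝕜) ≠ 0 := by exact_mod_cast hj
      simp only [map_inv₀, RCLike.conj_ofReal]
      field_simp
    · simp
  obtain ⟨f, hf⟩ := horth.exists_orthonormalBasis_extension_of_card_eq (by simpa using hF)
  refine ⟨e, f, fun k => ?_⟩
  change T (e k) = (s k : 𝕜) • f k
  by_cases hk : s k = 0
  · have : T (e k) = 0 := by rw [← inner_self_eq_zero (𝕜 := 𝕜), hinner, if_pos rfl, hk]; simp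
    simp [hk, this]
  · rw [hf k hk, smul_inv_smul₀ (by exact_mod_cast hk)]

open scoped Matrix

variable {N : ℕ}

theorem exists_eq_unitary_mul_diagonal_singularValues_mul {𝕜 : Type*} [RCLike 𝕜]
    (C : Matrix (Fin N) (Fin N) 𝕜) :
    ∃ U ∈ Matrix.unitaryGroup (Fin N) 𝕜, ∃ V ∈ Matrix.unitaryGroup (Fin N) 𝕜,
      C = U * Matrix.diagonal (fun k : Fin N => ((Matrix.toEuclideanLin C).singularValues k : 𝕜))
        * Vᴴ := by
  have hN : Module.finrank 𝕜 (EuclideanSpace 𝕜 (Fin N)) = N := by simp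
  obtain ⟨e, f, hef⟩ :=
    exists_orthonormalBasis_apply_eq_singularValues_smul hN hN (Matrix.toEuclideanLin C)
  set b := EuclideanSpace.basisFun (Fin N) 𝕜
  have hV := b.toMatrix_orthonormalBasis_mem_unitary e
  refine ⟨b.toBasis.toMatrix f, b.toMatrix_orthonormalBasis_mem_unitary f,
    b.toBasis.toMatrix e, hV, ?_⟩
  suffices C * b.toBasis.toMatrix e = b.toBasis.toMatrix f * Matrix.diagonal _ by
    rw [← this, mul_assoc, ← Matrix.star_eq_conjTranspose, Matrix.mem_unitaryGroup_iff.1 hV,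
      mul_one]
  ext n k
  rw [Matrix.mul_diagonal, mul_comm]
  exact congr_arg (· n) (hef k)

theorem norm_trace_mul_le {U : Matrix (Fin N) (Fin N) ℂ} (hU : U ∈ Matrix.unitaryGroup (Fin N) ℂ)
    (C : Matrix (Fin N) (Fin N) ℂ) : ‖(U * C).trace‖ ≤ matrixTraceNorm C := by
  obtain ⟨V, hV, W, hW, hC⟩ := exists_eq_unitary_mul_diagonal_singularValues_mul C
  set s : Fin N → ℝ := fun k => (Matrix.toEuclideanLin C).singularValues k
  have hmem : Wᴴ * U * V ∈ Matrix.unitaryGroup (Fin N) ℂ :=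
    mul_mem (mul_mem (Unitary.star_mem hW) hU) hV
  calc ‖(U * C).trace‖ = ‖∑ k, (Wᴴ * U * V) k k * s k‖ := by
        conv_lhs => rw [hC, ← mul_assoc, Matrix.trace_mul_comm, ← mul_assoc, ← mul_assoc]
        simp [Matrix.trace, Matrix.mul_diagonal, s]
    _ ≤ ∑ k, ‖(Wᴴ * U * V) k k * s k‖ := norm_sum_le _ _
    _ ≤ ∑ k, s k := by
        refine Finset.sum_le_sum fun k _ => ?_
        have hs : 0 ≤ s k := LinearMap.singularValues_nonneg _ _
        rw [norm_mul, Complex.norm_of_nonneg hs]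
        exact mul_le_of_le_one_left hs (entry_norm_bound_of_unitary hmem k k)

theorem exists_unitary_trace_mul_eq_matrixTraceNorm (C : Matrix (Fin N) (Fin N) ℂ) :
    ∃ U ∈ Matrix.unitaryGroup (Fin N) ℂ, (U * C).trace = (matrixTraceNorm C : ℂ) := by
  obtain ⟨V, hV, W, hW, hC⟩ := exists_eq_unitary_mul_diagonal_singularValues_mul C
  refine ⟨W * Vᴴ, mul_mem hW (Unitary.star_mem hV), ?_⟩
  have hVV : Vᴴ * V = 1 := Matrix.mem_unitaryGroup_iff'.1 hV
  have hWW : Wᴴ * W = 1 := Matrix.mem_unitaryGroup_iff'.1 hW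
  conv_lhs => rw [hC, mul_assoc, Matrix.trace_mul_comm, mul_assoc V, ← mul_assoc Vᴴ, hVV, one_mul,
    mul_assoc, hWW, mul_one]
  simp [Matrix.trace, matrixTraceNorm]

/-- Trace norm duality: the trace norm is the supremum of `|tr(UC)|` over unitaries `U`. -/
theorem matrixTraceNorm_le_iff {C : Matrix (Fin N) (Fin N) ℂ} {r : ℝ} :
    matrixTraceNorm C ≤ r ↔ ∀ U ∈ Matrix.unitaryGroup (Fin N) ℂ, ‖(U * C).trace‖ ≤ r := by
  refine ⟨fun h U hU => (norm_trace_mul_le hU C).trans h, fun h => ?_⟩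
  obtain ⟨U, hU, hUC⟩ := exists_unitary_trace_mul_eq_matrixTraceNorm C
  exact (le_abs_self _).trans (by simpa [hUC] using h U hU)

theorem matrixTraceNorm_smul_le (c : ℂ) (C : Matrix (Fin N) (Fin N) ℂ) :
    matrixTraceNorm (c • C) ≤ ‖c‖ * matrixTraceNorm C := by
  refine matrixTraceNorm_le_iff.2 fun U hU => ?_
  rw [Matrix.mul_smul, Matrix.trace_smul, norm_smul]
  gcongr
  exact norm_trace_mul_le hU C

theorem matrixTraceNorm_le_of_hasSum {σ : Type*} {C : σ → Matrix (Fin N) (Fin N) ℂ}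
    {D : Matrix (Fin N) (Fin N) ℂ} {b : σ → ℝ} {w : ℝ} (hC : HasSum C D) (hb : HasSum b w)
    (h : ∀ s, matrixTraceNorm (C s) ≤ b s) : matrixTraceNorm D ≤ w := by
  refine matrixTraceNorm_le_iff.2 fun U hU => ?_
  have hsum : HasSum (fun s => (U * C s).trace) (U * D).trace :=
    hC.map ((Matrix.traceAddMonoidHom (Fin N) ℂ).comp (AddMonoidHom.mulLeft U)) (by
      change Continuous fun X : Matrix (Fin N) (Fin N) ℂ => (U * X).trace
      fun_prop)
  rw [← hsum.tsum_eq]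
  exact tsum_of_norm_bounded hb fun s => (norm_trace_mul_le hU (C s)).trans (h s)

theorem sum_sq_norm_unitary_smul {𝕜 E ι : Type*} [RCLike 𝕜] [NormedAddCommGroup E]
    [InnerProductSpace 𝕜 E] [Fintype ι] [DecidableEq ι] {U : Matrix ι ι 𝕜}
    (hU : U ∈ Matrix.unitaryGroup ι 𝕜) (a : ι → E) :
    ∑ i, ‖∑ j, U i j • a j‖ ^ 2 = ∑ j, ‖a j‖ ^ 2 := by
  have hentry (j k : ι) : ∑ i, conj (U i j) * U i k = (1 : Matrix ι ι 𝕜) j k := by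
    rw [← Matrix.mem_unitaryGroup_iff'.1 hU]
    simp [Matrix.mul_apply]
  suffices ∑ i, ⟪∑ j, U i j • a j, ∑ j, U i j • a j⟫_𝕜 = ∑ j, ⟪a j, a j⟫_𝕜 by
    simp only [inner_self_eq_norm_sq_to_K] at this
    exact_mod_cast this
  calc ∑ i, ⟪∑ j, U i j • a j, ∑ k, U i k • a k⟫_𝕜
      = ∑ i, ∑ j, ∑ k, conj (U i j) * U i k * ⟪a j, a k⟫_𝕜 := by
        refine Finset.sum_congr rfl fun i _ => ?_
        rw [sum_inner]
        simp only [inner_smul_left, inner_sum, inner_smul_right, mul_assoc, mul_left_comm]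
    _ = ∑ j, ∑ k, (∑ i, conj (U i j) * U i k) * ⟪a j, a k⟫_𝕜 := by
        simp only [Finset.sum_mul]
        rw [Finset.sum_comm]
        exact Finset.sum_congr rfl fun j _ => Finset.sum_comm
    _ = ∑ j, ⟪a j, a j⟫_𝕜 := by simp [hentry, Matrix.one_apply]

theorem matrixTraceNorm_inner_le {E : Type*} [NormedAddCommGroup E] [InnerProductSpace ℂ E]
    (a b : Fin N → E) :
    matrixTraceNorm (Matrix.of fun n n' => ⟪a n, b n'⟫_ℂ)
      ≤ √(∑ n, ‖a n‖ ^ 2) * √(∑ n, ‖b n‖ ^ 2) := by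
  refine matrixTraceNorm_le_iff.2 fun U hU => ?_
  have htrace : (U * Matrix.of fun n n' => ⟪a n, b n'⟫_ℂ).trace
      = ∑ n, ⟪a n, ∑ n', Uᵀ n n' • b n'⟫_ℂ := by
    simp only [Matrix.trace, Matrix.diag_apply, Matrix.mul_apply, Matrix.of_apply, inner_sum,
      inner_smul_right, Matrix.transpose_apply]
    exact Finset.sum_comm
  calc ‖(U * Matrix.of fun n n' => ⟪a n, b n'⟫_ℂ).trace‖
      ≤ ∑ n, ‖a n‖ * ‖∑ n', Uᵀ n n' • b n'‖ := by
        rw [htrace]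
        exact norm_sum_le_of_le _ fun n _ => norm_inner_le_norm _ _
    _ ≤ √(∑ n, ‖a n‖ ^ 2) * √(∑ n, ‖∑ n', Uᵀ n n' • b n'‖ ^ 2) :=
        Real.sum_mul_le_sqrt_mul_sqrt _ _ _
    _ = √(∑ n, ‖a n‖ ^ 2) * √(∑ n, ‖b n‖ ^ 2) := by
        rw [sum_sq_norm_unitary_smul (Matrix.transpose_mem_unitaryGroup_iff.2 hU)]

end TraceNorm

/-! ### Displacements and the relative parity -/

section WeightedComp

variable {ι : Type} [Fintype ι] {S T : (ι → ℝ) → (ι → ℝ)} {u v : (ι → ℝ) → ℂ}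

theorem weightedComp_congr (hS : MeasurePreserving S) (hT : MeasurePreserving T)
    (hu : Measurable u) (hu1 : ∀ x, ‖u x‖ = 1) (hv : Measurable v) (hv1 : ∀ x, ‖v x‖ = 1)
    (hST : ∀ x, S x = T x) (huv : ∀ x, u x = v x) :
    weightedComp S hS u hu hu1 = weightedComp T hT v hv hv1 := by
  obtain rfl := funext hST
  obtain rfl := funext huv
  rfl

theorem weightedComp_id :
    weightedComp (id : (ι → ℝ) → (ι → ℝ)) (.id volume) (fun _ => 1) measurable_const
      (fun _ => norm_one) = ContinuousLinearMap.id ℂ (ModeSpace ι) := by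
  ext1 f
  exact Lp.ext <| (coeFn_weightedComp ..).trans (.of_forall fun x => by simp)

theorem norm_weightedComp (hS : MeasurePreserving S) (hu : Measurable u)
    (hu1 : ∀ x, ‖u x‖ = 1) (f : ModeSpace ι) : ‖weightedComp S hS u hu hu1 f‖ = ‖f‖ := by
  rw [Lp.norm_def, Lp.norm_def, ← eLpNorm_comp_measurePreserving (Lp.aestronglyMeasurable f) hS]
  congr 1
  refine eLpNorm_congr_norm_ae ?_
  filter_upwards [coeFn_weightedComp S hS u hu hu1 f] with x hx
  rw [hx, norm_mul, hu1, one_mul, Function.comp_apply]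

theorem weightedComp_comp_weightedComp (hS : MeasurePreserving S) (hT : MeasurePreserving T)
    (hu : Measurable u) (hu1 : ∀ x, ‖u x‖ = 1) (hv : Measurable v) (hv1 : ∀ x, ‖v x‖ = 1) :
    weightedComp S hS u hu hu1 ∘L weightedComp T hT v hv hv1 =
      weightedComp (T ∘ S) (hT.comp hS) (fun x => u x * v (S x)) (hu.mul (hv.comp hS.measurable))
        (fun x => by rw [norm_mul, hu1, hv1, one_mul]) := by
  ext1 f
  refine Lp.ext ?_
  filter_upwards [coeFn_weightedComp S hS u hu hu1 (weightedComp T hT v hv hv1 f),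
    hS.quasiMeasurePreserving.ae (coeFn_weightedComp T hT v hv hv1 f),
    coeFn_weightedComp (T ∘ S) (hT.comp hS) (fun x => u x * v (S x))
      (hu.mul (hv.comp hS.measurable)) (fun x => by rw [norm_mul, hu1, hv1, one_mul]) f]
    with x hx hx' hx''
  rw [ContinuousLinearMap.comp_apply, hx, hx', hx'', mul_assoc, Function.comp_apply]

/-- An isometry with a right inverse is unitary. -/
theorem adjoint_weightedComp (hS : MeasurePreserving S) (hT : MeasurePreserving T)
    (hu : Measurable u) (hu1 : ∀ x, ‖u x‖ = 1) (hv : Measurable v) (hv1 : ∀ x, ‖v x‖ = 1)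
    (hST : ∀ x, T (S x) = x) (huv : ∀ x, u x * v (S x) = 1) :
    (weightedComp S hS u hu hu1).adjoint = weightedComp T hT v hv hv1 := by
  set U := weightedComp S hS u hu hu1
  set V := weightedComp T hT v hv hv1
  have hUV : U ∘L V = .id ℂ _ := by
    rw [weightedComp_comp_weightedComp, ← weightedComp_id]
    exact weightedComp_congr _ _ _ _ _ _ hST huv
  have hU : U.adjoint ∘L U = .id ℂ _ :=
    (ContinuousLinearMap.norm_map_iff_adjoint_comp_self U).1 (norm_weightedComp hS hu hu1)
  calc U.adjoint = U.adjoint ∘L (U ∘L V) := by rw [hUV, ContinuousLinearMap.comp_id]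
    _ = V := by rw [← ContinuousLinearMap.comp_assoc, hU, ContinuousLinearMap.id_comp]

end WeightedComp

theorem adjoint_displacement {ι : Type} [Fintype ι] (α : ι → ℂ) :
    (displacement α).adjoint = displacement (-α) := by
  refine adjoint_weightedComp _ _ _ _ _ _ (fun x => ?_) (fun x => ?_)
  · ext m; simp
  · rw [← Finset.prod_mul_distrib]
    refine Finset.prod_eq_one fun m _ => ?_
    rw [← Complex.exp_add, ← add_mul, ← Complex.ofReal_add]
    simp only [Pi.neg_apply, Complex.neg_re, Complex.neg_im, Pi.sub_apply]
    ring_nf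
    simp

theorem prod_exp_const_displacement {ι : Type} [Fintype ι] (p q : ℝ) (x : ι → ℝ) :
    ∏ m, Complex.exp (((p * x m - q * p / 2 : ℝ) : ℂ) * Complex.I)
      = Complex.exp (((p * (∑ m, x m - Fintype.card ι * q / 2) : ℝ) : ℂ) * Complex.I) := by
  rw [← Complex.exp_sum, ← Finset.sum_mul, ← Complex.ofReal_sum, Finset.sum_sub_distrib,
    ← Finset.mul_sum, Finset.sum_const, Finset.card_univ, nsmul_eq_mul]
  ring_nf

theorem relReflection_apply {M : ℕ} (x : Fin M → ℝ) (m : Fin M) :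
    relReflection M x m = -x m + 2 / M * ∑ m', x m' := rfl

theorem relReflection_const {M : ℕ} (c : ℝ) : relReflection M (fun _ => c) = fun _ => c := by
  ext m
  have : (M : ℝ) ≠ 0 := by exact_mod_cast m.pos.ne'
  simp only [relReflection_apply, Finset.sum_const, Finset.card_univ, Fintype.card_fin,
    nsmul_eq_mul]
  field_simp
  ring

theorem sum_relReflection {M : ℕ} (x : Fin M → ℝ) : ∑ m, relReflection M x m = ∑ m, x m := by
  rcases M.eq_zero_or_pos with rfl | hM
  · simp
  · simp only [relReflection_apply, Finset.sum_add_distrib, Finset.sum_neg_distrib,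
      Finset.sum_const, Finset.card_univ, Fintype.card_fin, nsmul_eq_mul]
    field_simp
    ring

theorem adjoint_relParity (M : ℕ) : (relParity M).adjoint = relParity M :=
  adjoint_weightedComp _ _ _ _ _ _
    (fun x => LinearMap.congr_fun (relReflection_relReflection M) x) (fun _ => one_mul _)

theorem relParity_comp_displacement_const (M : ℕ) (ξ : ℂ) :
    relParity M ∘L displacement (fun _ => ξ) = displacement (fun _ => ξ) ∘L relParity M := by
  rw [relParity, displacement, weightedComp_comp_weightedComp, weightedComp_comp_weightedComp]
  refine weightedComp_congr _ _ _ _ _ _ (fun x => ?_) (fun x => ?_)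
  · simp only [Function.comp_apply, map_sub, relReflection_const]
  · simp only [prod_exp_const_displacement, sum_relReflection, one_mul, mul_one]

/-- The operator `Π_{-M} D(ξ·1)`, whose expectation values are the entries of the witness matrix. -/
def displacedParity (M : ℕ) (ξ : ℂ) : ModeSpace (Fin M) →L[ℂ] ModeSpace (Fin M) :=
  relParity M ∘L displacement fun _ => ξ

theorem adjoint_displacedParity (M : ℕ) (ξ : ℂ) :
    (displacedParity M ξ).adjoint = displacedParity M (-ξ) := by
  rw [displacedParity, ContinuousLinearMap.adjoint_comp, adjoint_displacement, adjoint_relParity,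
    displacedParity, relParity_comp_displacement_const]
  rfl

theorem coeFn_displacedParity {M : ℕ} (ξ : ℂ) (f : ModeSpace (Fin M)) :
    displacedParity M ξ f =ᵐ[volume] fun x =>
      Complex.exp (((√2 * ξ.im * (∑ m, x m - M * (√2 * ξ.re) / 2) : ℝ) : ℂ) * Complex.I) *
        f (relReflection M x - fun _ => √2 * ξ.re) := by
  rw [displacedParity, relParity, displacement, weightedComp_comp_weightedComp]
  refine (coeFn_weightedComp ..).trans (.of_forall fun x => ?_)
  simp only [prod_exp_const_displacement, sum_relReflection, one_mul, Fintype.card_fin,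
    Function.comp_apply]

/-! ### The measurement circuit and the witness matrix -/

section Circuit

variable {H : Type} [NormedAddCommGroup H] [InnerProductSpace ℂ H]

theorem qubitTensor_apply (A : Matrix (Fin 2) (Fin 2) ℂ) (T : H →L[ℂ] H) (f : WithQubit H)
    (i : Fin 2) : qubitTensor A T f i = ∑ j, A i j • T (f j) := by
  simp [qubitTensor]

theorem controlled_apply_zero (U : H →L[ℂ] H) (f : WithQubit H) : controlled U f 0 = f 0 := by
  simp [controlled, qubitTensor_apply]

theorem controlled_apply_one (U : H →L[ℂ] H) (f : WithQubit H) : controlled U f 1 = U (f 1) := by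
  simp [controlled, qubitTensor_apply]

/-- The map `f ↦ |↑⟩ ⊗ f + |↓⟩ ⊗ f`, a multiple of the preparation of the qubit in `|+⟩`. -/
def diagonal (H : Type) [NormedAddCommGroup H] [InnerProductSpace ℂ H] : H →L[ℂ] WithQubit H :=
  (PiLp.continuousLinearEquiv 2 ℂ (fun _ : Fin 2 => H)).symm.toContinuousLinearMap ∘L
    ContinuousLinearMap.pi fun _ => ContinuousLinearMap.id ℂ H

/-- The map `|↑⟩ ⊗ f + |↓⟩ ⊗ g ↦ (f + g) / 2`, normalised so that `|+⟩⟨+| ⊗ T` is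
`diagonal H ∘L T ∘L average H`. -/
def average (H : Type) [NormedAddCommGroup H] [InnerProductSpace ℂ H] : WithQubit H →L[ℂ] H :=
  (1 / 2 : ℂ) • ∑ j, PiLp.proj 2 (fun _ : Fin 2 => H) j

theorem qubitTensor_plus (T : H →L[ℂ] H) :
    qubitTensor !![1/2, 1/2; 1/2, 1/2] T = diagonal H ∘L T ∘L average H := by
  ext f i
  fin_cases i <;> simp [qubitTensor_apply, diagonal, average]

variable [CompleteSpace H]

theorem adjoint_controlled (U : H →L[ℂ] H) :
    (controlled U).adjoint = controlled U.adjoint := by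
  refine ((ContinuousLinearMap.eq_adjoint_iff _ _).2 fun f g => ?_).symm
  simp [PiLp.inner_apply, Fin.sum_univ_two, controlled_apply_zero, controlled_apply_one,
    ContinuousLinearMap.adjoint_inner_left]

/-- The phase kickback on the control qubit, read out by `σₓ`. -/
theorem average_comp_controlled_comp_diagonal (U V : H →L[ℂ] H) :
    average H ∘L (controlled U).adjoint ∘L qubitTensor !![0, 1; 1, 0] V ∘L controlled U ∘L
      diagonal H = (1 / 2 : ℂ) • (V ∘L U + U.adjoint ∘L V) := by
  ext1 f
  simp [adjoint_controlled, average, diagonal, Fin.sum_univ_two, controlled_apply_zero,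
    controlled_apply_one, qubitTensor_apply]

end Circuit

section WitnessMatrix

variable {M N : ℕ} {σ : Type*} {v : σ → ModeSpace (Fin M)} {w : ℝ}
  {ρ : ModeSpace (Fin M) →L[ℂ] ModeSpace (Fin M)}

theorem IsEnsemble.hasTrace_comp_displacedParity (h : IsEnsemble v w ρ) (ξ : ℂ) :
    HasTrace (ρ ∘L displacedParity M ξ) (∑' s, ⟪v s, displacedParity M ξ (v s)⟫_ℂ) :=
  h.hasTrace_comp (.id ℂ _) _

theorem IsEnsemble.hasTrace_circuitOperator (h : IsEnsemble v w ρ) (ξ : ℂ) :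
    HasTrace (circuitOperator ρ ξ) (∑' s, ⟪v s, displacedParity M ξ (v s)⟫_ℂ) := by
  have hkick := average_comp_controlled_comp_diagonal (relParity M) (displacement fun _ => ξ)
  rw [adjoint_relParity, ← relParity_comp_displacement_const, ← two_smul ℂ, smul_smul, one_div,
    inv_mul_cancel₀ two_ne_zero, one_smul] at hkick
  have htrace := h.hasTrace_comp
    (qubitTensor !![0, 1; 1, 0] (displacement fun _ => ξ) ∘L controlled (relParity M) ∘L diagonal _)
    (average _ ∘L (controlled (relParity M)).adjoint)
  have hentry (s : σ) := DFunLike.congr_fun hkick (v s)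
  simp only [ContinuousLinearMap.comp_apply] at hentry htrace
  simp only [hentry] at htrace
  rw [circuitOperator, qubitTensor_plus]
  exact htrace

/-- The unnormalised witness matrix `⟨v|Π_{-M} D((ξₙ - ξₙ')·1)|v⟩` of the pure state `|v⟩⟨v|`. -/
def parityMatrix (v : ModeSpace (Fin M)) (ξ : Fin N → ℂ) : Matrix (Fin N) (Fin N) ℂ :=
  Matrix.of fun n n' => ⟪v, displacedParity M (ξ n - ξ n') v⟫_ℂ

theorem isHermitian_parityMatrix (v : ModeSpace (Fin M)) (ξ : Fin N → ℂ) :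
    (parityMatrix v ξ).IsHermitian := by
  ext n n'
  simp only [Matrix.conjTranspose_apply, parityMatrix, Matrix.of_apply, Complex.star_def]
  rw [inner_conj_symm, ← ContinuousLinearMap.adjoint_inner_right, adjoint_displacedParity, neg_sub]

theorem IsEnsemble.witnessMatrix_apply (h : IsEnsemble v w ρ) (ξ : Fin N → ℂ) (n n' : Fin N) :
    witnessMatrix ρ ξ n n' = 1 / N * ∑' s, ⟪v s, displacedParity M (ξ n - ξ n') (v s)⟫_ℂ := by
  rw [← (h.hasTrace_comp_displacedParity _).trace_eq]
  rfl

theorem IsEnsemble.hasSum_witnessMatrix (h : IsEnsemble v w ρ) (ξ : Fin N → ℂ) :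
    HasSum (fun s => (1 / N : ℂ) • parityMatrix (v s) ξ) (witnessMatrix ρ ξ) := by
  refine Pi.hasSum.2 fun n => Pi.hasSum.2 fun n' => ?_
  rw [h.witnessMatrix_apply]
  exact (h.summable_inner _).hasSum.mul_left _

theorem IsEnsemble.isHermitian_witnessMatrix (h : IsEnsemble v w ρ) (ξ : Fin N → ℂ) :
    (witnessMatrix ρ ξ).IsHermitian := by
  have hsum := h.hasSum_witnessMatrix ξ
  refine hsum.matrix_conjTranspose.unique ?_
  convert hsum using 2 with s
  rw [Matrix.conjTranspose_smul, (isHermitian_parityMatrix _ _).eq]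
  simp

end WitnessMatrix

/-! ### Product vectors -/

theorem ae_eq_zero_of_forall_setIntegral_eq_zero_of_isPiSystem {α E : Type*}
    [m : MeasurableSpace α] [NormedAddCommGroup E] [NormedSpace ℝ E] [CompleteSpace E]
    {μ : Measure α} {C : Set (Set α)} (hm : m = .generateFrom C) (hC : IsPiSystem C) {h : α → E}
    (hint : Integrable h μ) (huniv : ∫ z, h z ∂μ = 0) (hzero : ∀ s ∈ C, ∫ z in s, h z ∂μ = 0) :
    h =ᵐ[μ] 0 := by
  suffices key : ∀ s, MeasurableSet s → ∫ z in s, h z ∂μ = 0 from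
    hint.ae_eq_zero_of_forall_setIntegral_eq_zero fun s hs _ => key s hs
  intro s hs
  induction s, hs using MeasurableSpace.induction_on_inter hm hC with
  | empty => simp
  | basic s hs => exact hzero s hs
  | compl s hs ih => rw [setIntegral_compl hs hint, ih, huniv, sub_zero]
  | iUnion f hdisj hf ih => simp [integral_iUnion hf hdisj hint.integrableOn, ih]

theorem ae_eq_zero_of_forall_setIntegral_prod_eq_zero {X Y E : Type*} [MeasurableSpace X]
    [MeasurableSpace Y] [NormedAddCommGroup E] [NormedSpace ℝ E] [CompleteSpace E] {μ : Measure X}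
    {ν : Measure Y} [SigmaFinite μ] [SigmaFinite ν] {h : X × Y → E}
    (hint : ∀ s t, μ s < ⊤ → ν t < ⊤ → IntegrableOn h (s ×ˢ t) (μ.prod ν))
    (hzero : ∀ s t, MeasurableSet s → MeasurableSet t → μ s < ⊤ → ν t < ⊤ →
      ∫ z in s ×ˢ t, h z ∂(μ.prod ν) = 0) : h =ᵐ[μ.prod ν] 0 := by
  set B : ℕ → Set (X × Y) := fun n => spanningSets μ n ×ˢ spanningSets ν n
  have hX := measurableSet_spanningSets μ
  have hY := measurableSet_spanningSets ν
  have hcover : ⋃ n, B n = Set.univ := by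
    rw [Set.iUnion_prod_of_monotone (monotone_spanningSets μ) (monotone_spanningSets ν),
      iUnion_spanningSets, iUnion_spanningSets, Set.univ_prod_univ]
  rw [← Measure.restrict_univ (μ := μ.prod ν), ← hcover]
  refine (ae_restrict_iUnion_iff _ _).2 fun n => ?_
  have hμ : μ (spanningSets μ n) < ⊤ := measure_spanningSets_lt_top μ n
  have hν : ν (spanningSets ν n) < ⊤ := measure_spanningSets_lt_top ν n
  refine ae_eq_zero_of_forall_setIntegral_eq_zero_of_isPiSystem generateFrom_prod.symm
    isPiSystem_prod (hint _ _ hμ hν) (hzero _ _ (hX n) (hY n) hμ hν) ?_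
  rintro _ ⟨s, hs, t, ht, rfl⟩
  rw [Measure.restrict_restrict (hs.prod ht), Set.prod_inter_prod]
  exact hzero _ _ (hs.inter (hX n)) (ht.inter (hY n))
    ((measure_mono Set.inter_subset_right).trans_lt hμ)
    ((measure_mono Set.inter_subset_right).trans_lt hν)

section Tensor

variable {M : ℕ} (A : Finset (Fin M))

/-- The splitting `ℝ^M ≃ ℝ^A × ℝ^Ā` of the positions along the bipartition `(A | Ā)`. -/
def splitModes : (Fin M → ℝ) ≃ᵐ ({m // m ∈ A} → ℝ) × ({m // m ∉ A} → ℝ) :=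
  MeasurableEquiv.piEquivPiSubtypeProd (fun _ => ℝ) (fun m => m ∈ A)

theorem splitModes_apply (x : Fin M → ℝ) :
    splitModes A x = (fun m : {m // m ∈ A} => x m, fun m : {m // m ∉ A} => x m) := rfl

theorem measurePreserving_splitModes : MeasurePreserving (splitModes A) := by
  convert volume_preserving_piEquivPiSubtypeProd (fun _ : Fin M => ℝ) (fun m => m ∈ A)
  any_goals rfl

theorem coeFn_tensor (f : ModeSpace {m // m ∈ A}) (g : ModeSpace {m // m ∉ A}) :
    tensor A f g =ᵐ[volume] fun x => f (splitModes A x).1 * g (splitModes A x).2 :=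
  (memLp_tensor A f g).coeFn_toLp

theorem inner_tensor (f f' : ModeSpace {m // m ∈ A}) (g g' : ModeSpace {m // m ∉ A}) :
    ⟪tensor A f g, tensor A f' g'⟫_ℂ = ⟪f, f'⟫_ℂ * ⟪g, g'⟫_ℂ := by
  rw [L2.inner_def, L2.inner_def, L2.inner_def, ← integral_prod_mul, ← Measure.volume_eq_prod,
    ← (measurePreserving_splitModes A).integral_comp']
  refine integral_congr_ae ?_
  filter_upwards [coeFn_tensor A f g, coeFn_tensor A f' g'] with x h1 h2
  rw [h1, h2]
  simp only [RCLike.inner_apply, map_mul]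
  ring

theorem norm_tensor (f : ModeSpace {m // m ∈ A}) (g : ModeSpace {m // m ∉ A}) :
    ‖tensor A f g‖ = ‖f‖ * ‖g‖ := by
  have h := inner_tensor A f f g g
  simp only [inner_self_eq_norm_sq_to_K, ← mul_pow] at h
  exact (pow_left_inj₀ (by positivity) (by positivity) two_ne_zero).1 (by exact_mod_cast h)

theorem tensor_smul_left (c : ℂ) (f : ModeSpace {m // m ∈ A}) (g : ModeSpace {m // m ∉ A}) :
    tensor A (c • f) g = c • tensor A f g := by
  refine Lp.ext ?_
  have hsmul := (measurePreserving_splitModes A).quasiMeasurePreserving.ae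
    (Measure.quasiMeasurePreserving_fst.ae (Lp.coeFn_smul c f))
  filter_upwards [hsmul, coeFn_tensor A (c • f) g, coeFn_tensor A f g,
    Lp.coeFn_smul c (tensor A f g)] with x h1 h2 h3 h4
  rw [h2, h4, h1, Pi.smul_apply, Pi.smul_apply, h3, smul_eq_mul, smul_eq_mul, mul_assoc]

theorem inner_tensor_indicatorConstLp (h : ModeSpace (Fin M)) {s : Set ({m // m ∈ A} → ℝ)}
    {t : Set ({m // m ∉ A} → ℝ)} (hs : MeasurableSet s) (ht : MeasurableSet t)
    (hs' : volume s ≠ ⊤) (ht' : volume t ≠ ⊤) :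
    ⟪tensor A (indicatorConstLp 2 hs hs' 1) (indicatorConstLp 2 ht ht' 1), h⟫_ℂ
      = ∫ z in s ×ˢ t, h ((splitModes A).symm z) := by
  have hE := measurePreserving_splitModes A
  rw [L2.inner_def, ← integral_indicator (hs.prod ht), ← hE.integral_comp']
  refine integral_congr_ae ?_
  have hind_s := hE.quasiMeasurePreserving.ae (Measure.quasiMeasurePreserving_fst.ae
    (indicatorConstLp_coeFn (p := 2) (hs := hs) (hμs := hs') (c := (1 : ℂ))))
  have hind_t := hE.quasiMeasurePreserving.ae (Measure.quasiMeasurePreserving_snd.ae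
    (indicatorConstLp_coeFn (p := 2) (hs := ht) (hμs := ht') (c := (1 : ℂ))))
  filter_upwards [hind_s, hind_t, coeFn_tensor A (indicatorConstLp 2 hs hs' 1)
    (indicatorConstLp 2 ht ht' 1)] with x h1 h2 h3
  rw [h3, h1, h2]
  by_cases hx1 : (splitModes A x).1 ∈ s <;> by_cases hx2 : (splitModes A x).2 ∈ t <;>
    simp [Set.indicator, Set.mem_prod, hx1, hx2]

theorem eq_zero_of_forall_inner_tensor_eq_zero {h : ModeSpace (Fin M)}
    (hzero : ∀ f g, ⟪tensor A f g, h⟫_ℂ = 0) : h = 0 := by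
  have hE := measurePreserving_splitModes A
  have hmem : MemLp (fun z => h ((splitModes A).symm z)) 2 (volume.prod volume) :=
    (Lp.memLp h).comp_measurePreserving hE.symm
  have hsplit : (fun z => h ((splitModes A).symm z)) =ᵐ[volume.prod volume] 0 := by
    refine ae_eq_zero_of_forall_setIntegral_prod_eq_zero (fun s t hs ht => ?_)
      fun s t hs ht hs' ht' =>
        (inner_tensor_indicatorConstLp A h hs ht hs'.ne ht'.ne).symm.trans (hzero _ _)
    have hfin : (volume.prod volume) (s ×ˢ t) < ⊤ := by
      rw [Measure.prod_prod]
      exact ENNReal.mul_lt_top hs ht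
    have := isFiniteMeasure_restrict.2 hfin.ne
    exact (hmem.restrict _).integrable one_le_two
  refine Lp.ext ?_
  filter_upwards [hE.quasiMeasurePreserving.ae hsplit, Lp.coeFn_zero ℂ 2 volume] with x h1 h2
  rw [MeasurableEquiv.symm_apply_apply] at h1
  exact h1.trans h2.symm

theorem eq_of_forall_inner_tensor_apply_tensor_eq
    {T T' : ModeSpace (Fin M) →L[ℂ] ModeSpace (Fin M)}
    (h : ∀ f g f' g',
      ⟪tensor A f g, T (tensor A f' g')⟫_ℂ = ⟪tensor A f g, T' (tensor A f' g')⟫_ℂ) :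
    T = T' := by
  have htensor (f g) : (T - T') (tensor A f g) = 0 :=
    eq_zero_of_forall_inner_tensor_eq_zero A fun f' g' => by simp [inner_sub_right, h]
  have hadjoint : (T - T').adjoint = 0 := by
    ext1 x
    exact eq_zero_of_forall_inner_tensor_eq_zero A fun f g => by
      rw [ContinuousLinearMap.adjoint_inner_right, htensor, inner_zero_left]
  rw [← sub_eq_zero, ← ContinuousLinearMap.adjoint_adjoint (T - T'), hadjoint, map_zero]

end Tensor

/-! ### Biseparable mixtures as ensembles of product vectors -/

section Biseparable

variable {M : ℕ}

theorem IsProductState.exists_isEnsemble {A : Finset (Fin M)}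
    {T : ModeSpace (Fin M) →L[ℂ] ModeSpace (Fin M)} (hT : IsProductState A T) :
    ∃ (σ : Type) (φ : σ → ModeSpace {m // m ∈ A}) (χ : σ → ModeSpace {m // m ∉ A}),
      IsEnsemble (fun s => tensor A (φ s) (χ s)) 1 T := by
  obtain ⟨ρA, ρB, hA, hB, hAB⟩ := hT
  obtain ⟨σ, φ, hφ⟩ := hA.exists_isEnsemble
  obtain ⟨τ, χ, hχ⟩ := hB.exists_isEnsemble
  have hweight : HasSum (fun p : σ × τ => ‖tensor A (φ p.1) (χ p.2)‖ ^ 2) 1 := by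
    simp only [norm_tensor, mul_pow]
    have hsum := hφ.hasSum_weight.summable.mul_of_nonneg hχ.hasSum_weight.summable
      (fun _ => by positivity) (fun _ => by positivity)
    simpa using hφ.hasSum_weight.mul hχ.hasSum_weight hsum
  obtain ⟨T', hT'⟩ := summable_rankOne hweight.summable
  have hensemble : IsEnsemble (fun p : σ × τ => tensor A (φ p.1) (χ p.2)) 1 T' := ⟨hweight, hT'⟩
  suffices T = T' from ⟨σ × τ, fun p => φ p.1, fun p => χ p.2, this ▸ hensemble⟩
  refine eq_of_forall_inner_tensor_apply_tensor_eq A fun f g f' g' => ?_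
  have hprod := hensemble.hasSum_inner (tensor A f g) (tensor A f' g')
  simp only [inner_tensor, mul_mul_mul_comm _ _ ⟪φ _, _⟫_ℂ] at hprod
  rw [hAB, inner_tensor]
  exact ((hφ.hasSum_inner f f').mul (hχ.hasSum_inner g g') hprod.summable).unique hprod

/-- The vector `v` is a product with respect to some bipartition of the modes into two nonempty
parts: the vectors into which biseparable mixtures decompose. -/
def IsBiproduct (v : ModeSpace (Fin M)) : Prop :=
  ∃ (A : Finset (Fin M)) (f : ModeSpace {m // m ∈ A}) (g : ModeSpace {m // m ∉ A}),
    A.Nonempty ∧ Aᶜ.Nonempty ∧ v = tensor A f g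

theorem IsBiproduct.smul {v : ModeSpace (Fin M)} (hv : IsBiproduct v) (c : ℂ) :
    IsBiproduct (c • v) := by
  obtain ⟨A, f, g, hA, hAc, rfl⟩ := hv
  exact ⟨A, c • f, g, hA, hAc, (tensor_smul_left A c f g).symm⟩

theorem IsBiseparableMixture.exists_isEnsemble {ρ : ModeSpace (Fin M) →L[ℂ] ModeSpace (Fin M)}
    (hρ : IsBiseparableMixture ρ) :
    ∃ (σ : Type) (v : σ → ModeSpace (Fin M)), (∀ s, IsBiproduct (v s)) ∧ IsEnsemble v 1 ρ := by
  obtain ⟨p, A, T, hp, hp1, hT, hρ⟩ := hρ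
  choose σ φ χ h using fun k => (hT k).2.2.exists_isEnsemble
  have hk (k : ℕ) := (h k).smul (hp k)
  simp only [mul_one] at hk
  exact ⟨Σ k, σ k, _, fun s => .smul ⟨A s.1, φ s.1 s.2, χ s.1 s.2, (hT s.1).1, (hT s.1).2.1, rfl⟩ _,
    IsEnsemble.sigma hk hp1 hρ⟩

end Biseparable

/-! ### Coordinates adapted to the total positions of two blocks of modes -/

theorem measurePreserving_prodProdProdComm {X Y Z W : Type*} [MeasureSpace X] [MeasureSpace Y]
    [MeasureSpace Z] [MeasureSpace W] [SFinite (volume : Measure X)] [SFinite (volume : Measure Y)]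
    [SFinite (volume : Measure Z)] [SFinite (volume : Measure W)] :
    MeasurePreserving fun p : (X × Y) × (Z × W) => ((p.1.1, p.2.1), (p.1.2, p.2.2)) := by
  have hX := MeasurePreserving.id (volume : Measure X)
  have hW := MeasurePreserving.id (volume : Measure W)
  have hYZ : MeasurePreserving (Prod.swap : Y × Z → Z × Y) := Measure.measurePreserving_swap
  have hXYZW : MeasurePreserving (MeasurableEquiv.prodAssoc : (X × Y) × (Z × W) ≃ᵐ _) :=
    volume_preserving_prodAssoc
  have hYZW : MeasurePreserving (MeasurableEquiv.prodAssoc : (Y × Z) × W ≃ᵐ _) :=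
    volume_preserving_prodAssoc
  have hZYW : MeasurePreserving (MeasurableEquiv.prodAssoc : (Z × Y) × W ≃ᵐ _) :=
    volume_preserving_prodAssoc
  have hXZYW : MeasurePreserving (MeasurableEquiv.prodAssoc : (X × Z) × (Y × W) ≃ᵐ _) :=
    volume_preserving_prodAssoc
  exact hXZYW.symm.comp ((hX.prod hZYW).comp ((hX.prod (hYZ.prod hW)).comp
    ((hX.prod hYZW.symm).comp hXYZW)))

theorem map_linear_prod_real {a b c d : ℝ} (h : a * d - b * c ≠ 0) :
    Measure.map (fun p : ℝ × ℝ => (a * p.1 + b * p.2, c * p.1 + d * p.2)) volume =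
      ENNReal.ofReal |(a * d - b * c)⁻¹| • volume := by
  let L : ℝ × ℝ →ₗ[ℝ] ℝ × ℝ :=
    Matrix.toLin (Module.Basis.finTwoProd ℝ) (Module.Basis.finTwoProd ℝ) !![a, b; c, d]
  have hL : ⇑L = fun p : ℝ × ℝ => (a * p.1 + b * p.2, c * p.1 + d * p.2) := by
    ext p <;> simp [L, Matrix.toLin_finTwoProd_apply]
  have hdet : LinearMap.det L = a * d - b * c := by simp [L, Matrix.det_fin_two]
  rw [← hL, ← hdet]
  exact Measure.map_linearMap_addHaar_eq_smul_addHaar volume (by rwa [hdet])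

theorem map_add_prod_sub {m l : ℝ} (h : 0 < m + l) (c : ℝ) :
    Measure.map (fun t : ℝ × ℝ => (m * t.1 + t.2, l * t.1 + (c - t.2))) volume =
      ENNReal.ofReal (1 / (m + l)) • volume := by
  have hdet : m * -1 - 1 * l = -(m + l) := by ring
  have hlin := map_linear_prod_real (a := m) (b := 1) (c := l) (d := -1)
    (hdet ▸ neg_ne_zero.2 h.ne')
  rw [hdet, abs_inv, abs_neg, abs_of_pos h, ← one_div] at hlin
  have htranslate : MeasurePreserving fun p : ℝ × ℝ => p + (0, c) :=
    measurePreserving_add_right volume _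
  have hcomp : (fun t : ℝ × ℝ => (m * t.1 + t.2, l * t.1 + (c - t.2)))
      = (fun p => p + (0, c)) ∘ fun p => (m * p.1 + 1 * p.2, l * p.1 + -1 * p.2) := by
    ext t <;> simp only [Function.comp_apply, Prod.mk_add_mk] <;> ring
  rw [hcomp, ← Measure.map_map htranslate.measurable (by fun_prop), hlin, Measure.map_smul,
    htranslate.map_eq]

section Coordinates

variable {ι : Type*} [Fintype ι] [DecidableEq ι] (i₀ : ι)

/-- The point of `ℝ^ι` with total position `p.1` whose coordinates other than `i₀` are `p.2`: the
coordinates on `ℝ^ι` in which the centre of mass is separated from the relative positions. -/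
def ofTotal (p : ℝ × ({i // i ≠ i₀} → ℝ)) (i : ι) : ℝ :=
  if h : i = i₀ then p.1 - ∑ j, p.2 j else p.2 ⟨i, h⟩

theorem sum_ofTotal (p : ℝ × ({i // i ≠ i₀} → ℝ)) : ∑ i, ofTotal i₀ p i = p.1 := by
  have hrest (j : {i // i ≠ i₀}) : ofTotal i₀ p j = p.2 j := dif_neg j.2
  rw [Fintype.sum_eq_add_sum_subtype_ne _ i₀, Fintype.sum_congr _ _ hrest]
  simp [ofTotal]

theorem const_sub_ofTotal (y : ℝ) (p : ℝ × ({i // i ≠ i₀} → ℝ)) :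
    (fun _ => 2 * y) - ofTotal i₀ p
      = ofTotal i₀ (2 * Fintype.card ι * y - p.1, (fun _ => 2 * y) - p.2) := by
  have hcard : (Fintype.card ι : ℝ) = 1 + Fintype.card {i // i ≠ i₀} := by
    simpa using Fintype.sum_eq_add_sum_subtype_ne (fun _ => (1 : ℝ)) i₀
  ext i
  by_cases h : i = i₀
  · simp only [ofTotal, h, Pi.sub_apply, Finset.sum_sub_distrib, dite_true, Finset.sum_const,
      Finset.card_univ, nsmul_eq_mul, hcard]
    ring
  · simp [ofTotal, h]

@[fun_prop]
theorem measurable_ofTotal : Measurable (ofTotal i₀) := by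
  refine measurable_pi_lambda _ fun i => ?_
  by_cases h : i = i₀
  · simp only [ofTotal, h, dite_true]
    fun_prop
  · simp only [ofTotal, h, dite_false]
    fun_prop

theorem measurePreserving_ofTotal : MeasurePreserving (ofTotal i₀) := by
  have hsplit : MeasurePreserving
      (MeasurableEquiv.piEquivPiSubtypeProd (fun _ : ι => ℝ) (fun i => i = i₀)).symm := by
    convert! (volume_preserving_piEquivPiSubtypeProd (fun _ : ι => ℝ) (fun i => i = i₀)).symm
  have hunique : MeasurePreserving (MeasurableEquiv.funUnique {i // i = i₀} ℝ).symm := by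
    convert! (volume_preserving_funUnique {i // i = i₀} ℝ).symm
  have hswap : MeasurePreserving (Prod.swap : ℝ × ({i // i ≠ i₀} → ℝ) → _) :=
    Measure.measurePreserving_swap
  have hswap' : MeasurePreserving (Prod.swap : ({i // i ≠ i₀} → ℝ) × ℝ → _) :=
    Measure.measurePreserving_swap
  have hshear : MeasurePreserving fun p : ({i // i ≠ i₀} → ℝ) × ℝ => (p.1, p.2 - ∑ j, p.1 j) :=
    (MeasurePreserving.id volume).skew_product
      (g := fun (z : {i // i ≠ i₀} → ℝ) (r : ℝ) => r - ∑ j, z j) (by fun_prop)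
      (.of_forall fun z => map_sub_right_eq_self volume _)
  convert! hsplit.comp ((hunique.prod (MeasurePreserving.id volume)).comp
    (hswap'.comp (hshear.comp hswap))) using 1

end Coordinates

section BlockCoordinates

variable {ι κ : Type*} [Fintype ι] [DecidableEq ι] [Fintype κ] [DecidableEq κ] (i₀ : ι) (k₀ : κ)

/-- The point of `ℝ^ι × ℝ^κ` with coordinates `((y, s), (z, w))`: the total positions of the two
blocks of modes are `|ι| y + s` and `|κ| y + c - s`, the relative positions are `z` and `w`. Thus
`y` is the mean position up to the constant `c`, and `s` an exchange between the blocks. -/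
def blockCoord (c : ℝ) (q : (ℝ × ℝ) × (({i // i ≠ i₀} → ℝ) × ({k // k ≠ k₀} → ℝ))) :
    (ι → ℝ) × (κ → ℝ) :=
  (ofTotal i₀ (Fintype.card ι * q.1.1 + q.1.2, q.2.1),
    ofTotal k₀ (Fintype.card κ * q.1.1 + (c - q.1.2), q.2.2))

@[fun_prop]
theorem measurable_blockCoord (c : ℝ) : Measurable (blockCoord i₀ k₀ c) := by
  unfold blockCoord
  fun_prop

theorem map_blockCoord (c : ℝ) :
    Measure.map (blockCoord i₀ k₀ c) volume =
      ENNReal.ofReal (1 / (Fintype.card ι + Fintype.card κ)) • volume := by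
  have : Nonempty ι := ⟨i₀⟩
  have hpos : (0 : ℝ) < Fintype.card ι + Fintype.card κ := by positivity
  have hassemble := ((measurePreserving_ofTotal i₀).prod (measurePreserving_ofTotal k₀)).comp
    measurePreserving_prodProdProdComm
  have hcomp : blockCoord i₀ k₀ c = (Prod.map (ofTotal i₀) (ofTotal k₀) ∘
      fun p => ((p.1.1, p.2.1), (p.1.2, p.2.2))) ∘ Prod.map (fun t : ℝ × ℝ =>
        (Fintype.card ι * t.1 + t.2, Fintype.card κ * t.1 + (c - t.2))) id := rfl
  rw [hcomp, ← Measure.map_map hassemble.measurable (by fun_prop), Measure.volume_eq_prod,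
    ← Measure.map_prod_map _ _ (by fun_prop) measurable_id, Measure.map_id,
    map_add_prod_sub hpos c, Measure.prod_smul_left, Measure.map_smul]
  exact congrArg _ hassemble.map_eq

theorem integral_eq_mul_integral_integral_blockCoord (c : ℝ) {h : (ι → ℝ) × (κ → ℝ) → ℂ}
    (hint : Integrable h) :
    ∫ x, h x = ((Fintype.card ι + Fintype.card κ : ℝ) : ℂ) *
      ∫ t, ∫ z, h (blockCoord i₀ k₀ c (t, z)) := by
  have : Nonempty ι := ⟨i₀⟩
  have hpos : (0 : ℝ) < Fintype.card ι + Fintype.card κ := by positivity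
  have hmap := map_blockCoord i₀ k₀ c
  have hintmap : Integrable h (Measure.map (blockCoord i₀ k₀ c) volume) :=
    hmap ▸ hint.smul_measure ENNReal.ofReal_ne_top
  have hfubini := integral_prod (μ := volume) (ν := volume) _
    (hintmap.comp_measurable (measurable_blockCoord i₀ k₀ c))
  have hval := integral_map (measurable_blockCoord i₀ k₀ c).aemeasurable
    hintmap.aestronglyMeasurable
  rw [hmap, integral_smul_measure, ENNReal.toReal_ofReal (by positivity), Complex.real_smul] at hval
  simp only [Function.comp_apply] at hfubini
  rw [← hfubini, ← Measure.volume_eq_prod, ← hval, ← mul_assoc, ← Complex.ofReal_mul,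
    mul_one_div_cancel hpos.ne', Complex.ofReal_one, one_mul]

end BlockCoordinates

/-! ### Correlations along the fibres of constant total position -/

theorem sq_lintegral_mul_le {X : Type*} [MeasurableSpace X] {μ : Measure X} {f g : X → ENNReal}
    (hf : AEMeasurable f μ) (hg : AEMeasurable g μ) :
    (∫⁻ x, f x * g x ∂μ) ^ 2 ≤ (∫⁻ x, f x ^ 2 ∂μ) * ∫⁻ x, g x ^ 2 ∂μ := by
  have h := ENNReal.lintegral_mul_le_Lp_mul_Lq μ Real.HolderConjugate.two_two hf hg
  simp only [ENNReal.rpow_two, Pi.mul_apply] at h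
  calc _ ≤ ((∫⁻ x, f x ^ 2 ∂μ) ^ (1 / 2 : ℝ) * (∫⁻ x, g x ^ 2 ∂μ) ^ (1 / 2 : ℝ)) ^ 2 := by gcongr
    _ = _ := by
      rw [mul_pow, ← ENNReal.rpow_two, ← ENNReal.rpow_two, ← ENNReal.rpow_mul, ← ENNReal.rpow_mul]
      norm_num

theorem sq_eLpNorm_two {X E : Type*} [MeasurableSpace X] {μ : Measure X} [NormedAddCommGroup E]
    (f : X → E) : eLpNorm f 2 μ ^ 2 = ∫⁻ x, ‖f x‖ₑ ^ 2 ∂μ := by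
  simpa using eLpNorm_nnreal_pow_eq_lintegral (f := f) (μ := μ) (p := 2) two_ne_zero

section Correlation

variable {ι : Type} [Fintype ι] [DecidableEq ι] (i₀ : ι)

/-- The partial Wigner correlation of `φ` and `ψ` at the diagonal point `(y, …, y)`, `y = t.1`: the
integral of `x ↦ φ(x)* ψ(2y - x)` over the fibre on which the total position is `|ι| y + t.2`. -/
def fibreCorr (φ ψ : (ι → ℝ) → ℂ) (t : ℝ × ℝ) : ℂ :=
  ∫ z, conj (φ (ofTotal i₀ (Fintype.card ι * t.1 + t.2, z))) *
    ψ ((fun _ => 2 * t.1) - ofTotal i₀ (Fintype.card ι * t.1 + t.2, z))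

/-- The mass of `|φ|²` on the fibre with total position `r`. -/
def fibreMass (φ : (ι → ℝ) → ℂ) (r : ℝ) : ENNReal :=
  ∫⁻ z, ‖φ (ofTotal i₀ (r, z))‖ₑ ^ 2

theorem stronglyMeasurable_fibreCorr {φ ψ : (ι → ℝ) → ℂ} (hφ : Measurable φ)
    (hψ : Measurable ψ) : StronglyMeasurable (fibreCorr i₀ φ ψ) := by
  refine StronglyMeasurable.integral_prod_right' (f := fun q : (ℝ × ℝ) × ({i // i ≠ i₀} → ℝ) =>
    conj (φ (ofTotal i₀ (Fintype.card ι * q.1.1 + q.1.2, q.2))) *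
      ψ ((fun _ => 2 * q.1.1) - ofTotal i₀ (Fintype.card ι * q.1.1 + q.1.2, q.2))) ?_
  refine Measurable.stronglyMeasurable (.mul ?_ (by fun_prop))
  exact Complex.continuous_conj.measurable.comp (by fun_prop)

theorem measurable_fibreMass {φ : (ι → ℝ) → ℂ} (hφ : Measurable φ) :
    Measurable (fibreMass i₀ φ) :=
  Measurable.lintegral_prod_right' (f := fun q : ℝ × ({i // i ≠ i₀} → ℝ) =>
    ‖φ (ofTotal i₀ q)‖ₑ ^ 2) (by fun_prop)

theorem lintegral_fibreMass {φ : (ι → ℝ) → ℂ} (hφ : Measurable φ) :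
    ∫⁻ r, fibreMass i₀ φ r = eLpNorm φ 2 volume ^ 2 := by
  rw [sq_eLpNorm_two, ← (measurePreserving_ofTotal i₀).lintegral_comp
    (f := fun x => ‖φ x‖ₑ ^ 2) (by fun_prop), Measure.volume_eq_prod,
    lintegral_prod _ (by fun_prop)]
  rfl

theorem sq_enorm_fibreCorr_le {φ ψ : (ι → ℝ) → ℂ} (hφ : Measurable φ) (hψ : Measurable ψ)
    (t : ℝ × ℝ) :
    ‖fibreCorr i₀ φ ψ t‖ₑ ^ 2 ≤ fibreMass i₀ φ (Fintype.card ι * t.1 + t.2) *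
      fibreMass i₀ ψ (Fintype.card ι * t.1 + (0 - t.2)) := by
  have hreflect : ∫⁻ z, ‖ψ ((fun _ => 2 * t.1) - ofTotal i₀ (Fintype.card ι * t.1 + t.2, z))‖ₑ ^ 2
      = fibreMass i₀ ψ (Fintype.card ι * t.1 + (0 - t.2)) := by
    have htotal : 2 * Fintype.card ι * t.1 - (Fintype.card ι * t.1 + t.2)
        = Fintype.card ι * t.1 + (0 - t.2) := by ring
    simp only [const_sub_ofTotal, htotal]
    exact lintegral_sub_left_eq_self (fun z => ‖ψ (ofTotal i₀ (_, z))‖ₑ ^ 2) _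
  rw [← hreflect, fibreMass]
  refine le_trans ?_ (sq_lintegral_mul_le (by fun_prop) (by fun_prop))
  gcongr
  refine (enorm_integral_le_lintegral_enorm _).trans (le_of_eq (lintegral_congr fun z => ?_))
  rw [enorm_mul, RCLike.enorm_conj]

theorem sq_eLpNorm_fibreCorr_le {φ ψ : (ι → ℝ) → ℂ} (hφ : Measurable φ) (hψ : Measurable ψ) :
    eLpNorm (fibreCorr i₀ φ ψ) 2 volume ^ 2 ≤ ENNReal.ofReal (1 / (2 * Fintype.card ι)) *
      (eLpNorm φ 2 volume ^ 2 * eLpNorm ψ 2 volume ^ 2) := by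
  have : Nonempty ι := ⟨i₀⟩
  have hmφ := measurable_fibreMass i₀ hφ
  have hmψ := measurable_fibreMass i₀ hψ
  have hmap := map_add_prod_sub (m := Fintype.card ι) (l := Fintype.card ι) (by positivity) 0
  calc eLpNorm (fibreCorr i₀ φ ψ) 2 volume ^ 2
    _ ≤ ∫⁻ t : ℝ × ℝ, fibreMass i₀ φ (Fintype.card ι * t.1 + t.2) *
          fibreMass i₀ ψ (Fintype.card ι * t.1 + (0 - t.2)) :=
        (sq_eLpNorm_two _).trans_le (lintegral_mono (sq_enorm_fibreCorr_le i₀ hφ hψ))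
    _ = ENNReal.ofReal (1 / (2 * Fintype.card ι)) *
          ∫⁻ r : ℝ × ℝ, fibreMass i₀ φ r.1 * fibreMass i₀ ψ r.2 := by
        rw [two_mul, ← smul_eq_mul, ← lintegral_smul_measure, ← hmap,
          lintegral_map (by fun_prop) (by fun_prop)]
    _ = _ := by
        rw [Measure.volume_eq_prod, lintegral_prod_mul hmφ.aemeasurable hmψ.aemeasurable,
          lintegral_fibreMass i₀ hφ, lintegral_fibreMass i₀ hψ]

theorem memLp_fibreCorr (φ ψ : ModeSpace ι) : MemLp (fibreCorr i₀ φ ψ) 2 volume := by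
  have hφ := (Lp.stronglyMeasurable φ).measurable
  have hψ := (Lp.stronglyMeasurable ψ).measurable
  refine ⟨(stronglyMeasurable_fibreCorr i₀ hφ hψ).aestronglyMeasurable, ?_⟩
  refine (ENNReal.pow_lt_top_iff.1 ((sq_eLpNorm_fibreCorr_le i₀ hφ hψ).trans_lt ?_)).resolve_right
    two_ne_zero
  exact ENNReal.mul_lt_top ENNReal.ofReal_lt_top (ENNReal.mul_lt_top
    (ENNReal.pow_lt_top (Lp.eLpNorm_lt_top φ)) (ENNReal.pow_lt_top (Lp.eLpNorm_lt_top ψ)))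

theorem lpNorm_fibreCorr_le (φ ψ : ModeSpace ι) :
    lpNorm (fibreCorr i₀ φ ψ) 2 volume ≤ ‖φ‖ * ‖ψ‖ / √(2 * Fintype.card ι) := by
  have hsq := sq_eLpNorm_fibreCorr_le i₀ (Lp.stronglyMeasurable φ).measurable
    (Lp.stronglyMeasurable ψ).measurable
  have htop (χ : ModeSpace ι) : eLpNorm χ 2 volume ≠ ⊤ := Lp.eLpNorm_ne_top χ
  have hreal := ENNReal.toReal_mono (by finiteness [htop φ, htop ψ]) hsq
  rw [ENNReal.toReal_mul, ENNReal.toReal_mul, ENNReal.toReal_pow, ENNReal.toReal_pow,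
    ENNReal.toReal_pow, ENNReal.toReal_ofReal (by positivity),
    toReal_eLpNorm (memLp_fibreCorr i₀ φ ψ).1, ← Lp.norm_def, ← Lp.norm_def] at hreal
  refine le_of_sq_le_sq ?_ (by positivity)
  rw [div_pow, Real.sq_sqrt (by positivity)]
  exact hreal.trans_eq (by ring)

end Correlation

section BlockIntegral

variable {ι κ : Type} [Fintype ι] [DecidableEq ι] [Fintype κ] [DecidableEq κ] (i₀ : ι) (k₀ : κ)

/-- The mean position of two blocks of modes, relative to `c`: the first coordinate `y` of
`blockCoord`. -/
def blockMean (c : ℝ) (x : (ι → ℝ) × (κ → ℝ)) : ℝ :=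
  (∑ i, x.1 i + ∑ k, x.2 k - c) / (Fintype.card ι + Fintype.card κ)

theorem blockMean_blockCoord (c : ℝ)
    (q : (ℝ × ℝ) × (({i // i ≠ i₀} → ℝ) × ({k // k ≠ k₀} → ℝ))) :
    blockMean c (blockCoord i₀ k₀ c q) = q.1.1 := by
  have : Nonempty ι := ⟨i₀⟩
  have hpos : (0 : ℝ) < Fintype.card ι + Fintype.card κ := by positivity
  rw [blockMean, blockCoord, sum_ofTotal, sum_ofTotal, div_eq_iff hpos.ne']
  ring

/-- The integrand `θ(y) φ(x₁)* ψ(2y - x₁) χ(x₂)* ω(2y - x₂)`, where `y` is the mean position of the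
blocks relative to `c`: matrix elements of displaced relative parities have this form. -/
def blockIntegrand (θ : ℝ → ℂ) (c : ℝ) (φ ψ : (ι → ℝ) → ℂ) (χ ω : (κ → ℝ) → ℂ)
    (x : (ι → ℝ) × (κ → ℝ)) : ℂ :=
  θ (blockMean c x) * ((conj (φ x.1) * ψ ((fun _ => 2 * blockMean c x) - x.1)) *
    (conj (χ x.2) * ω ((fun _ => 2 * blockMean c x) - x.2)))

theorem integral_blockIntegrand {θ : ℝ → ℂ} {c : ℝ} {φ ψ : (ι → ℝ) → ℂ} {χ ω : (κ → ℝ) → ℂ}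
    (hint : Integrable (blockIntegrand θ c φ ψ χ ω)) :
    ∫ x, blockIntegrand θ c φ ψ χ ω x = ((Fintype.card ι + Fintype.card κ : ℝ) : ℂ) *
      ∫ t, θ t.1 * (fibreCorr i₀ φ ψ t * fibreCorr k₀ χ ω (t.1, c - t.2)) := by
  rw [integral_eq_mul_integral_integral_blockCoord i₀ k₀ c hint]
  congr 2 with t
  simp only [blockIntegrand, blockMean_blockCoord, fibreCorr]
  simp only [blockCoord]
  rw [integral_const_mul, ← integral_prod_mul, Measure.volume_eq_prod]

end BlockIntegral

/-! ### The trace norm bound for biseparable mixtures -/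

theorem exists_Lp_coeFn_eq_mul_comp {X : Type*} [MeasurableSpace X] {μ : Measure X}
    {p : ENNReal} {G : X → ℂ} (hG : MemLp G p μ) {S : X → X} (hS : MeasurePreserving S μ μ)
    {u : X → ℂ} (hu : Measurable u) (hu1 : ∀ x, ‖u x‖ = 1) :
    ∃ a : Lp ℂ p μ, a =ᵐ[μ] (fun x => u x * G (S x)) ∧ ‖a‖ = lpNorm G p μ := by
  have hGS := hG.comp_measurePreserving hS
  have hnorm : ∀ᵐ x ∂μ, ‖u x * G (S x)‖ = ‖G (S x)‖ := .of_forall fun x => by simp [hu1]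
  have hmem : MemLp (fun x => u x * G (S x)) p μ :=
    (memLp_congr_norm (hu.aestronglyMeasurable.mul hGS.1) hGS.1 hnorm).2 hGS
  refine ⟨hmem.toLp, hmem.coeFn_toLp, ?_⟩
  rw [Lp.norm_toLp, eLpNorm_congr_norm_ae hnorm, ← toReal_eLpNorm hG.1]
  exact congrArg _ (eLpNorm_comp_measurePreserving hG.1 hS)

theorem integral_exp_sub_mul_eq_integral_shift (p p' c c' : ℝ) (G H : ℝ × ℝ → ℂ) :
    ∫ t : ℝ × ℝ, Complex.exp ((((p - p') * t.1 : ℝ) : ℂ) * Complex.I) *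
        (G t * H (t.1, c - c' - t.2)) =
      ∫ t : ℝ × ℝ, Complex.exp ((-(p' * t.1) : ℝ) * Complex.I) * H (t.1, -c' - t.2) *
        conj (Complex.exp ((-(p * t.1) : ℝ) * Complex.I) * conj (G (t.1, t.2 + c))) := by
  rw [← integral_add_right_eq_self _ ((0, c) : ℝ × ℝ)]
  refine integral_congr_ae (.of_forall fun t => ?_)
  have hphase : (((p - p') * t.1 : ℝ) : ℂ) * Complex.I
      = (-(p' * t.1) : ℝ) * Complex.I + (p * t.1 : ℝ) * Complex.I := by
    push_cast
    ring
  have hconj : conj (Complex.exp ((-(p * t.1) : ℝ) * Complex.I))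
      = Complex.exp ((p * t.1 : ℝ) * Complex.I) := by
    rw [← Complex.exp_conj, map_mul, Complex.conj_ofReal, Complex.conj_I]
    push_cast
    ring_nf
  have hpos : c - c' - (t.2 + c) = -c' - t.2 := by ring
  simp only [Prod.add_def, add_zero, hphase, hpos, Complex.exp_add, map_mul, hconj,
    Complex.conj_conj]
  ring

theorem matrixTraceNorm_integral_exp_mul_le {N : ℕ} {G H : ℝ × ℝ → ℂ}
    (hG : MemLp G 2 volume) (hH : MemLp H 2 volume) (p c : Fin N → ℝ) :
    matrixTraceNorm (Matrix.of fun n n' => ∫ t : ℝ × ℝ,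
      Complex.exp ((((p n - p n') * t.1 : ℝ) : ℂ) * Complex.I) *
        (G t * H (t.1, c n - c n' - t.2))) ≤
      N * (lpNorm G 2 volume * lpNorm H 2 volume) := by
  have hphase (n : Fin N) (t : ℝ × ℝ) : ‖Complex.exp ((-(p n * t.1) : ℝ) * Complex.I)‖ = 1 :=
    Complex.norm_exp_ofReal_mul_I _
  choose a ha ha' using fun n => exists_Lp_coeFn_eq_mul_comp (S := fun t => (t.1, t.2 + c n))
    hG.star ((MeasurePreserving.id volume).prod (measurePreserving_add_right volume (c n)))
    (by fun_prop) (hphase n)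
  choose b hb hb' using fun n => exists_Lp_coeFn_eq_mul_comp (S := fun t => (t.1, -c n - t.2))
    hH ((MeasurePreserving.id volume).prod (Measure.measurePreserving_sub_left volume (-c n)))
    (by fun_prop) (hphase n)
  have hinner : (Matrix.of fun n n' => ∫ t : ℝ × ℝ,
      Complex.exp ((((p n - p n') * t.1 : ℝ) : ℂ) * Complex.I) *
        (G t * H (t.1, c n - c n' - t.2))) = Matrix.of fun n n' => ⟪a n, b n'⟫_ℂ := by
    ext n n'
    rw [Matrix.of_apply, Matrix.of_apply, integral_exp_sub_mul_eq_integral_shift, L2.inner_def]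
    refine integral_congr_ae ?_
    filter_upwards [ha n, hb n'] with t hat hbt
    rw [RCLike.inner_apply, hat, hbt]
    rfl
  have hstar : lpNorm (star G) 2 volume = lpNorm G 2 volume := by
    rw [← toReal_eLpNorm hG.star.1, ← toReal_eLpNorm hG.1, eLpNorm_star]
  rw [hinner]
  refine (matrixTraceNorm_inner_le a b).trans_eq ?_
  simp only [ha', hb', hstar, Finset.sum_const, Finset.card_univ, Fintype.card_fin, nsmul_eq_mul]
  rw [← Real.sqrt_mul (by positivity), mul_mul_mul_comm, ← mul_pow, ← pow_two, ← mul_pow,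
    Real.sqrt_sq (mul_nonneg N.cast_nonneg (mul_nonneg lpNorm_nonneg lpNorm_nonneg))]

section Tensor

variable {M : ℕ} {A : Finset (Fin M)}

theorem sum_mem_add_sum_notMem (A : Finset (Fin M)) (x : Fin M → ℝ) :
    ∑ i : {m // m ∈ A}, x i + ∑ i : {m // m ∉ A}, x i = ∑ i, x i := by
  convert Fintype.sum_subtype_add_sum_subtype (fun m => m ∈ A) x

theorem card_mem_add_card_notMem (A : Finset (Fin M)) :
    (Fintype.card {m // m ∈ A} + Fintype.card {m // m ∉ A} : ℝ) = M := by
  simpa using sum_mem_add_sum_notMem A fun _ => 1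

theorem inner_tensor_displacedParity_ae (hM : M ≠ 0) (f f' : ModeSpace {m // m ∈ A})
    (g g' : ModeSpace {m // m ∉ A}) (ξ : ℂ) :
    (fun x => ⟪tensor A f g x, displacedParity M ξ (tensor A f' g') x⟫_ℂ) =ᵐ[volume]
      blockIntegrand (fun y => Complex.exp (((√2 * ξ.im * (M * y) : ℝ) : ℂ) * Complex.I))
        (M * (√2 * ξ.re) / 2) f f' g g' ∘ splitModes A := by
  have hmove : MeasurePreserving fun x : Fin M → ℝ => relReflection M x - fun _ => √2 * ξ.re :=
    (measurePreserving_sub_right volume _).comp (measurePreserving_relReflection M)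
  filter_upwards [coeFn_tensor A f g, coeFn_displacedParity ξ (tensor A f' g'),
    hmove.quasiMeasurePreserving.ae (coeFn_tensor A f' g')] with x htensor hparity htensor'
  have hmean : blockMean (M * (√2 * ξ.re) / 2) (splitModes A x)
      = (∑ m, x m - M * (√2 * ξ.re) / 2) / M := by
    rw [blockMean, card_mem_add_card_notMem, splitModes_apply, sum_mem_add_sum_notMem]
  have hphase : (M : ℝ) * ((∑ m, x m - M * (√2 * ξ.re) / 2) / M)
      = ∑ m, x m - M * (√2 * ξ.re) / 2 := by
    field_simp
  have hpoint : relReflection M x - (fun _ => √2 * ξ.re)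
      = (fun _ => 2 * ((∑ m, x m - M * (√2 * ξ.re) / 2) / M)) - x := by
    ext m
    rw [Pi.sub_apply, Pi.sub_apply, relReflection_apply]
    field_simp
    ring
  rw [htensor, hparity, htensor', RCLike.inner_apply, Function.comp_apply, blockIntegrand, hmean,
    hphase, hpoint, map_mul]
  simp only [splitModes_apply, Pi.sub_def]
  ring

theorem inner_tensor_displacedParity (i₀ : {m // m ∈ A}) (k₀ : {m // m ∉ A})
    (f f' : ModeSpace {m // m ∈ A}) (g g' : ModeSpace {m // m ∉ A}) (ξ : ℂ) :
    ⟪tensor A f g, displacedParity M ξ (tensor A f' g')⟫_ℂ =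
      (M : ℂ) * ∫ t : ℝ × ℝ, Complex.exp (((√2 * ξ.im * (M * t.1) : ℝ) : ℂ) * Complex.I) *
        (fibreCorr i₀ f f' t * fibreCorr k₀ g g' (t.1, M * (√2 * ξ.re) / 2 - t.2)) := by
  have hpres := measurePreserving_splitModes A
  have hae := inner_tensor_displacedParity_ae i₀.1.pos.ne' f f' g g' ξ
  have hint := (hpres.integrable_comp_emb (splitModes A).measurableEmbedding).1
    ((L2.integrable_inner _ _).congr hae)
  simp only [L2.inner_def, integral_congr_ae hae, Function.comp_apply]
  rw [hpres.integral_comp' (g := blockIntegrand _ _ f f' g g'),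
    integral_blockIntegrand i₀ k₀ hint, card_mem_add_card_notMem, Complex.ofReal_natCast]

theorem parityMatrix_tensor {N : ℕ} (i₀ : {m // m ∈ A}) (k₀ : {m // m ∉ A})
    (f : ModeSpace {m // m ∈ A}) (g : ModeSpace {m // m ∉ A}) (ξ : Fin N → ℂ) :
    parityMatrix (tensor A f g) ξ = (M : ℂ) • Matrix.of fun n n' =>
      ∫ t : ℝ × ℝ, Complex.exp ((((√2 * (ξ n).im * M - √2 * (ξ n').im * M) * t.1 : ℝ) : ℂ) *
        Complex.I) * (fibreCorr i₀ f f t * fibreCorr k₀ g g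
          (t.1, M * (√2 * (ξ n).re) / 2 - M * (√2 * (ξ n').re) / 2 - t.2)) := by
  ext n n'
  have hphase (t : ℝ × ℝ) : √2 * ((ξ n).im - (ξ n').im) * (M * t.1)
      = (√2 * (ξ n).im * M - √2 * (ξ n').im * M) * t.1 := by ring
  have hpos : M * (√2 * ((ξ n).re - (ξ n').re)) / 2
      = M * (√2 * (ξ n).re) / 2 - M * (√2 * (ξ n').re) / 2 := by ring
  rw [parityMatrix, Matrix.of_apply, inner_tensor_displacedParity i₀ k₀, Matrix.smul_apply,
    Matrix.of_apply, smul_eq_mul, Complex.sub_re, Complex.sub_im]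
  simp only [hphase, hpos]

theorem matrixTraceNorm_parityMatrix_tensor_le {N : ℕ} (hA : A.Nonempty) (hA' : Aᶜ.Nonempty)
    (f : ModeSpace {m // m ∈ A}) (g : ModeSpace {m // m ∉ A}) (ξ : Fin N → ℂ) :
    matrixTraceNorm (parityMatrix (tensor A f g) ξ) ≤
      N * (M / (2 * √(A.card * Aᶜ.card)) * ‖tensor A f g‖ ^ 2) := by
  obtain ⟨i₀, hi₀⟩ := hA
  obtain ⟨k₀, hk₀⟩ := hA'
  lift i₀ to {m // m ∈ A} using hi₀
  lift k₀ to {m // m ∉ A} using Finset.mem_compl.1 hk₀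
  have hcompl : Fintype.card {m // m ∉ A} = Aᶜ.card :=
    Fintype.card_of_subtype Aᶜ fun _ => Finset.mem_compl
  have hcorr := mul_le_mul (lpNorm_fibreCorr_le i₀ f f) (lpNorm_fibreCorr_le k₀ g g)
    lpNorm_nonneg (by positivity)
  rw [parityMatrix_tensor i₀ k₀]
  calc _ ≤ ‖(M : ℂ)‖ * (N * (lpNorm (fibreCorr i₀ f f) 2 volume *
          lpNorm (fibreCorr k₀ g g) 2 volume)) := by
        refine (matrixTraceNorm_smul_le _ _).trans ?_
        gcongr
        exact matrixTraceNorm_integral_exp_mul_le (memLp_fibreCorr i₀ f f)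
          (memLp_fibreCorr k₀ g g) _ _
    _ ≤ M * (N * (‖f‖ * ‖f‖ / √(2 * A.card) * (‖g‖ * ‖g‖ / √(2 * Aᶜ.card)))) := by
        rw [Fintype.card_coe, hcompl] at hcorr
        rw [Complex.norm_natCast]
        gcongr
    _ = _ := by
        have hsqrt : √(2 * A.card) * √(2 * Aᶜ.card) = 2 * √(A.card * Aᶜ.card) := by
          rw [← Real.sqrt_mul (by positivity), mul_mul_mul_comm, Real.sqrt_mul (by positivity),
            Real.sqrt_mul_self (by positivity)]
        rw [norm_tensor, div_mul_div_comm, hsqrt]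
        ring

end Tensor

theorem sub_one_le_card_mul_card_compl {α : Type*} [Fintype α] [DecidableEq α] {s : Finset α}
    (hs : s.Nonempty) (hs' : sᶜ.Nonempty) :
    (Fintype.card α - 1 : ℝ) ≤ s.card * sᶜ.card := by
  have hone : (1 : ℝ) ≤ s.card := by exact_mod_cast hs.card_pos
  have hone' : (1 : ℝ) ≤ sᶜ.card := by exact_mod_cast hs'.card_pos
  have hsum : (s.card + sᶜ.card : ℝ) = Fintype.card α := by exact_mod_cast s.card_add_card_compl
  nlinarith

theorem IsBiproduct.matrixTraceNorm_parityMatrix_le {M N : ℕ} {v : ModeSpace (Fin M)}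
    (hv : IsBiproduct v) (ξ : Fin N → ℂ) :
    matrixTraceNorm (parityMatrix v ξ) ≤ N * (M / (2 * √((M : ℝ) - 1)) * ‖v‖ ^ 2) := by
  obtain ⟨A, f, g, hA, hA', rfl⟩ := hv
  have hcard : (M : ℝ) - 1 ≤ A.card * Aᶜ.card := by
    simpa using sub_one_le_card_mul_card_compl hA hA'
  have hpos : (0 : ℝ) < M - 1 := by
    have hM : A.card + Aᶜ.card = M := by simp
    have h1M : 1 < M := by have := hA.card_pos; have := hA'.card_pos; omega
    exact sub_pos.2 (by exact_mod_cast h1M)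
  refine (matrixTraceNorm_parityMatrix_tensor_le hA hA' f g ξ).trans ?_
  gcongr

theorem IsBiseparableMixture.matrixTraceNorm_witnessMatrix_le {M N : ℕ}
    {ρ : ModeSpace (Fin M) →L[ℂ] ModeSpace (Fin M)} (hρ : IsBiseparableMixture ρ)
    (ξ : Fin N → ℂ) :
    matrixTraceNorm (witnessMatrix ρ ξ) ≤ M / (2 * √((M : ℝ) - 1)) := by
  obtain ⟨σ, v, hprod, hv⟩ := hρ.exists_isEnsemble
  refine matrixTraceNorm_le_of_hasSum (hv.hasSum_witnessMatrix ξ)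
    (by simpa using hv.hasSum_weight.mul_left (M / (2 * √((M : ℝ) - 1)))) fun s => ?_
  calc matrixTraceNorm ((1 / N : ℂ) • parityMatrix (v s) ξ)
    _ ≤ ‖(1 / N : ℂ)‖ * (N * (M / (2 * √((M : ℝ) - 1)) * ‖v s‖ ^ 2)) :=
        (matrixTraceNorm_smul_le _ _).trans
          (mul_le_mul_of_nonneg_left ((hprod s).matrixTraceNorm_parityMatrix_le ξ) (norm_nonneg _))
    _ = (1 / N * N) * (M / (2 * √((M : ℝ) - 1)) * ‖v s‖ ^ 2) := by
        rw [norm_div, norm_one, Complex.norm_natCast, mul_assoc]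
    _ ≤ M / (2 * √((M : ℝ) - 1)) * ‖v s‖ ^ 2 :=
        mul_le_of_le_one_left (by positivity) (by rw [one_div]; exact inv_mul_le_one)

end CVWitness

end

open CVWitness in
theorem mainTheorem4 (M : ℕ) (hM : 2 ≤ M)
    (ρ : ModeSpace (Fin M) →L[ℂ] ModeSpace (Fin M)) (hρ : IsDensity ρ)
    (N : ℕ) (ξ : Fin N → ℂ) :
    (∀ n n', ∃ c : ℂ,
      HasTrace (circuitOperator ρ (ξ n - ξ n')) c ∧
      HasTrace (ρ ∘L relParity M ∘L displacement fun _ : Fin M => ξ n - ξ n') c ∧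
      witnessMatrix ρ ξ n n' = 1 / (N : ℂ) * c) ∧
    (witnessMatrix ρ ξ).IsHermitian ∧
    (matrixTraceNorm (witnessMatrix ρ ξ) > (M : ℝ) / (2 * √((M : ℝ) - 1)) → IsGME ρ) := by
  obtain ⟨σ, v, hv⟩ := hρ.exists_isEnsemble
  refine ⟨fun n n' => ⟨∑' s, ⟪v s, displacedParity M (ξ n - ξ n') (v s)⟫_ℂ, ?_, ?_, ?_⟩, ?_, ?_⟩
  · exact hv.hasTrace_circuitOperator _
  · exact hv.hasTrace_comp_displacedParity _
  · exact hv.witnessMatrix_apply ξ n n'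
  · exact hv.isHermitian_witnessMatrix ξ
  · exact fun hlarge hmixture => hlarge.not_ge (hmixture.matrixTraceNorm_witnessMatrix_le ξ)
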